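/- **Setting.** Finitely many players $i\in\mathcal N$ have action sets $\mathcal X_i$ that are compact convex bodies in $d_i$-dimensional real normed spaces $\mathcal V_i$ with a basis $(e_{i,k})_{k\le d_i}$ (e.g. $\mathbb R^{d_i}$ with the standard basis), and $\mathcal X=\prod_i\mathcal X_i$, $\|x\|^2=\sum_i\|x_i\|^2$. At each stage $t=1,2,\dots$ a game $\mathcal G_t$ with payoff functions $u_{i,t}$ is played; each $u_{i,t}$ is $C^1$ on a neighborhood of $\mathcal X$ and concave in $x_i\in\mathcal X_i$. Write $v_{t}(x)=(\nabla_{x_i}u_{i,t}(x))_i$ for the profile of individual payoff gradients. There are constants $M,G,L$ such that $|u_{i,t}(x)|\le M$, $\|v_t(x)\|_*\le G$ and $\|v_t(x')-v_t(x)\|_*\le L\|x'-x\|$ for all $t$, $i$ and $x,x'\in\mathcal X$. The games may be random: there is a filtration $(\mathcal F_t)$ such that $u_{i,t}(x)$ is $\mathcal F_t$-measurable, and $M,G,L$ are deterministic. A game is *strictly monotone* if $\langle v(x')-v(x),x'-x\rangle<0$ for all $x\ne x'$ in $\mathcal X$, and *$\mu$-strongly monotone* if $\langle v(x')-v(x),x'-x\rangle\le-\mu\|x'-x\|^2$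 for all $x,x'\in\mathcal X$. **Algorithm.** Each player $i$ has a Lipschitz distance-generating function $h_i$ on $\mathcal X_i$: it is convex and lower semicontinuous on $\mathcal X_i$ ($+\infty$ elsewhere), its subdifferential has a continuous selection $\nabla h_i$ on the set $\mathcal X_i^\circ$ where it is nonempty, $\sup_{\mathcal X_i^\circ}\|\nabla h_i\|_*<\infty$, and for some $K_i>0$ one has $h_i(x')\ge h_i(x)+\langle\nabla h_i(x),x'-x\rangle+\frac{K_i}{2}\|x'-x\|^2$ for $x\in\mathcal X_i^\circ$, $x'\in\mathcal X_i$. Put $D_i(x',x)=h_i(x')-h_i(x)-\langle\nabla h_i(x),x'-x\rangle$. Let $\rho_i>0$ and $b_i\in\operatorname{int}\mathcal X_i$ be such that $b_i\pm \rho_ie_{i,k}\in\mathcal X_i$ for all $k$. Let $\gamma_t=\gamma\,t^{-p}$ and $\delta_t=\delta\,t^{-q}$ with $p,q\in(0,1]$, $\gamma>0$ and $0<\delta<\min_i\rho_i$. Start at $X_{i,1}=\arg\min h_i$. At each stage $t$, every player $i$ draws $U_{i,t}$ uniformly from $\{\pm e_{i,1},\dots,\pm e_{i,d_i}\}$, independently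 of the other players and of $\mathcal F_t$ (and $U_{i,t}$ is $\mathcal F_{t+1}$-measurable), plays $$\hat X_{i,t}=(1-\delta_t/\rho_i)X_{i,t}+(\delta_t/\rho_i)(b_i+\rho_iU_{i,t}),$$ observes the payoff $u_{i,t}(\hat X_t)$, forms the estimate $V_{i,t}=\frac{d_i}{\delta_t}\,u_{i,t}(\hat X_t)\,U_{i,t}^{*}$, where $U^*_{i,t}=\pm e_{i,k}^*$ if $U_{i,t}=\pm e_{i,k}$ and $(e_{i,k}^*)_k$ is the dual basis, and updates $$X_{i,t+1}=\arg\min_{x'\in\mathcal X_i}\{\langle\gamma_tV_{i,t},X_{i,t}-x'\rangle+D_i(x',X_{i,t})\}.$$ **Theorem.** (i) Let $\mathcal G$ be a strictly monotone game on $\mathcal X$, with $C^1$ individually concave payoffs and gradient profile $v$, such that almost surely $\sum_i\sup_{x\in\mathcal X}\|v_{i,t}(x)-v_i(x)\|_*=O(t^{-\beta})$, and let $p>\max\{1-\beta,\,1-q,\,\tfrac12+q\}$. Then $\mathcal G$ has a unique Nash equilibrium $x^*$, and $\hat X_t\to x^*$ almost surely. (ii) Suppose that all the $\mathcal G_t$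 are $\mu$-strongly monotone with a common $\mu>0$, and let $x_t^*$ be the Nash equilibrium of $\mathcal G_t$ (as a random variable, $\mathcal F_t$-measurable). Suppose that $\sum_{t=1}^T\|x^*_{t+1}-x^*_t\|\le C\,T^\beta$ almost surely for all $T\ge1$, with a constant $C$ and some $\beta\in[0,1)$. Then $$\mathbb E\Big[\sum_{t=1}^T\|\hat X_t-x_t^*\|^2\Big]=O\big(T^{1+2q-p}+T^{1-q}+T^{2p-2q+\beta}\big).$$ In particular, if $p=3(1-\beta)/5$ and $q=(1-\beta)/5$, the expected error is $O\big(T^{(4+\beta)/5}\big)$. -/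

import Mathlib

open MeasureTheory ProbabilityTheory Filter Topology Asymptotics

noncomputable section

namespace PayoffLearning

/-! ### Concave games -/

section Games

variable {ι : Type*} {E : ι → Type*}

/-- The action space `∏ i, A i`, inside the product of the players' ambient spaces, which carries
the norm `‖x‖² = ∑ i, ‖x i‖²`. -/
def actionSpace (A : ∀ i, Set (E i)) : Set (PiLp 2 E) :=
  {x | ∀ i, x i ∈ A i}

/-- The profile `(y; x₋ᵢ)`, in which player `i` plays `y` and all others play as in `x`. -/
def deviate [DecidableEq ι] (x : PiLp 2 E) (i : ι) (y : E i) : PiLp 2 E :=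
  WithLp.toLp 2 (Function.update (WithLp.ofLp x) i y)

/-- Nash equilibria of the game with action sets `A i` and payoff functions `u i`. -/
def IsNash [DecidableEq ι] (A : ∀ i, Set (E i)) (u : ι → PiLp 2 E → ℝ) (x : PiLp 2 E) : Prop :=
  x ∈ actionSpace A ∧ ∀ i, ∀ y ∈ A i, u i (deviate x i y) ≤ u i x

variable [Fintype ι] [DecidableEq ι] [∀ i, NormedAddCommGroup (E i)] [∀ i, NormedSpace ℝ (E i)]

/-- The profile `v(x) = (∇_{xᵢ} uᵢ(x))ᵢ` of individual payoff gradients, an element of the dual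
space; its norm `‖v‖² = ∑ i, ‖v i‖²` is the dual of the norm on profiles. -/
def payoffGradient (u : ι → PiLp 2 E → ℝ) (x : PiLp 2 E) :
    PiLp 2 (fun i => StrongDual ℝ (E i)) :=
  WithLp.toLp 2 fun i => fderiv ℝ (fun y : E i => u i (deviate x i y)) (x i)

/-- The duality pairing between dual profiles and profiles. -/
def pairing (v : PiLp 2 (fun i => StrongDual ℝ (E i))) (x : PiLp 2 E) : ℝ :=
  ∑ i, v i (x i)

/-- Continuously differentiable (on a neighborhood of the action space) and individually concave
payoff functions. -/
structure IsConcaveGame (A : ∀ i, Set (E i)) (u : ι → PiLp 2 E → ℝ) : Prop where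
  contDiff : ∀ i, ∃ U : Set (PiLp 2 E),
    IsOpen U ∧ actionSpace A ⊆ U ∧ ContDiffOn ℝ 1 (u i) U
  concave : ∀ i, ∀ x ∈ actionSpace A, ConcaveOn ℝ (A i) fun y => u i (deviate x i y)

def IsStrictlyMonotone (A : ∀ i, Set (E i)) (u : ι → PiLp 2 E → ℝ) : Prop :=
  ∀ x ∈ actionSpace A, ∀ x' ∈ actionSpace A, x' ≠ x →
    pairing (payoffGradient u x' - payoffGradient u x) (x' - x) < 0

/-- Strong monotonicity with modulus `μ`. -/
def IsStronglyMonotone (A : ∀ i, Set (E i)) (u : ι → PiLp 2 E → ℝ) (μ : ℝ) : Prop :=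
  ∀ x ∈ actionSpace A, ∀ x' ∈ actionSpace A,
    pairing (payoffGradient u x' - payoffGradient u x) (x' - x) ≤ -μ * ‖x' - x‖ ^ 2

/-- The distance `∑ i, sup_{x} ‖vᵢ(x) - v'ᵢ(x)‖_*` between two games. -/
def gameDistance (A : ∀ i, Set (E i)) (u u' : ι → PiLp 2 E → ℝ) : ℝ :=
  ∑ i, ⨆ x : actionSpace A, ‖payoffGradient u x i - payoffGradient u' x i‖

/-- A time-varying game, `u n ω` being the payoff functions of stage `n + 1`. The stage games may be
random, and may depend on everything that precedes the draws of the stage (`ℱ n`). Each one is a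
concave game; payoffs, payoff gradients and the Lipschitz constants of the latter are bounded
uniformly over all stages. -/
structure IsTimeVaryingGame {Ω : Type*} {mΩ : MeasurableSpace Ω} (ℱ : Filtration ℕ mΩ)
    (A : ∀ i, Set (E i)) (u : ℕ → Ω → ι → PiLp 2 E → ℝ) : Prop where
  measurable : ∀ n i, ∀ x ∈ actionSpace A, Measurable[ℱ n] fun ω => u n ω i x
  concave : ∀ n ω, IsConcaveGame A (u n ω)
  payoff_bounded : ∃ M : ℝ, ∀ n ω i, ∀ x ∈ actionSpace A, |u n ω i x| ≤ M
  gradient_bounded : ∃ G : ℝ, ∀ n ω, ∀ x ∈ actionSpace A, ‖payoffGradient (u n ω) x‖ ≤ G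
  gradient_lipschitz : ∃ L : ℝ, ∀ n ω, ∀ x ∈ actionSpace A, ∀ x' ∈ actionSpace A,
    ‖payoffGradient (u n ω) x' - payoffGradient (u n ω) x‖ ≤ L * ‖x' - x‖

end Games

/-! ### Distance-generating functions and prox-mappings -/

section Prox

variable {V : Type*} [NormedAddCommGroup V] [NormedSpace ℝ V]

/-- The subdifferential at `x ∈ C` of the function that equals `h` on `C` and `+∞` off `C`. -/
def subdifferential (C : Set V) (h : V → ℝ) (x : V) : Set (StrongDual ℝ V) :=
  {g | ∀ y ∈ C, h x + g (y - x) ≤ h y}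

/-- The prox-domain, where the subdifferential is nonempty. -/
def proxDomain (C : Set V) (h : V → ℝ) : Set V :=
  {x ∈ C | (subdifferential C h x).Nonempty}

/-- `h`, extended by `+∞` off the closed set `C`, is a distance-generating function on `C`, and `grad`
is the chosen continuous selection of its subdifferential. -/
structure IsDGF (C : Set V) (h : V → ℝ) (grad : V → StrongDual ℝ V) : Prop where
  nonempty : C.Nonempty
  lsc : LowerSemicontinuousOn h C
  convex : ConvexOn ℝ C h
  grad_continuous : ContinuousOn grad (proxDomain C h)
  grad_mem : ∀ x ∈ proxDomain C h, grad x ∈ subdifferential C h x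
  strong_convex : ∃ K : ℝ, 0 < K ∧ ∀ x ∈ proxDomain C h, ∀ y ∈ C,
    h x + grad x (y - x) + K / 2 * ‖y - x‖ ^ 2 ≤ h y

/-- A Lipschitz distance-generating function. -/
def IsLipschitzDGF (C : Set V) (h : V → ℝ) (grad : V → StrongDual ℝ V) : Prop :=
  IsDGF C h grad ∧ ∃ M : ℝ, ∀ x ∈ proxDomain C h, ‖grad x‖ ≤ M

/-- The Bregman divergence `D(y, x)`. -/
def bregman (h : V → ℝ) (grad : V → StrongDual ℝ V) (y x : V) : ℝ :=
  h y - h x - grad x (y - x)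

/-- `x'` is the point `P_x(v) = argmin_{y ∈ C} {⟨v, x - y⟩ + D(y, x)}`. -/
def IsProx (C : Set V) (h : V → ℝ) (grad : V → StrongDual ℝ V) (x : V) (v : StrongDual ℝ V)
    (x' : V) : Prop :=
  x' ∈ C ∧ IsMinOn (fun y => v (x - y) + bregman h grad y x) C x'

/-! ### Sampling and estimation -/

variable {d : ℕ}

/-- The label `(k, true)` stands for the direction `e_k` and `(k, false)` for `-e_k`. -/
abbrev Direction (d : ℕ) : Type := Fin d × Bool

/-- The sampling direction as a vector, in coordinates given by the basis `b`. -/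
def dirVec (b : Module.Basis (Fin d) ℝ V) (e : Direction d) : V :=
  if e.2 then b e.1 else -b e.1

/-- The sampling direction as a dual vector (`x ↦ ± x_k`, in coordinates). -/
def dirCovec [FiniteDimensional ℝ V] (b : Module.Basis (Fin d) ℝ V) (e : Direction d) :
    StrongDual ℝ V :=
  LinearMap.toContinuousLinearMap (if e.2 then b.coord e.1 else -b.coord e.1)

/-- The action that is actually played around the candidate action `x`. -/
def query (b : Module.Basis (Fin d) ℝ V) (base : V) (r δ : ℝ) (x : V) (e : Direction d) : V :=
  (1 - δ / r) • x + (δ / r) • (base + r • dirVec b e)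

/-- The single-point gradient estimate from the observed payoff `payoff`. -/
def spsaEstimate [FiniteDimensional ℝ V] (b : Module.Basis (Fin d) ℝ V) (δ payoff : ℝ)
    (e : Direction d) : StrongDual ℝ V :=
  ((d : ℝ) / δ * payoff) • dirCovec b e

end Prox

section Play

variable {ι : Type*} {Ω : Type*} {d : ι → ℕ}

/-- At each stage, every player draws a uniformly distributed direction, independently of the other
players and of everything that precedes the draws of the stage. -/
structure IsUniformSampling {mΩ : MeasurableSpace Ω} (P : Measure Ω) (ℱ : Filtration ℕ mΩ)
    (w : ℕ → Ω → ∀ i, Direction (d i)) : Prop where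
  measurable : ∀ n i, Measurable[ℱ (n + 1)] fun ω => w n ω i
  uniform : ∀ n i (e : Direction (d i)), P {ω | w n ω i = e} = ((2 * d i : ℕ) : ENNReal)⁻¹
  indep_players : ∀ n, iIndepFun (fun i ω => w n ω i) P
  indep_past : ∀ n, Indep (MeasurableSpace.comap (w n) inferInstance) (ℱ n) P

variable {E : ι → Type*} [∀ i, NormedAddCommGroup (E i)] [∀ i, NormedSpace ℝ (E i)]

/-- Safety parameters: interior points `base i` and radii `r i > 0` for which the points
`base i ± r i e_k` are feasible (as they are when the ball of radius `r i` around `base i` lies in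
`A i` and the basis vectors have norm at most one). -/
structure IsSafe (A : ∀ i, Set (E i)) (b : ∀ i, Module.Basis (Fin (d i)) ℝ (E i))
    (base : ∀ i, E i) (r : ι → ℝ) : Prop where
  radius_pos : ∀ i, 0 < r i
  base_mem : ∀ i, base i ∈ interior (A i)
  feasible : ∀ i e, base i + r i • dirVec (b i) e ∈ A i

/-- Payoff-based prox-learning: `X n` is the profile of candidate actions of stage `n + 1`, `Xhat n`
the profile of realized actions. -/
structure IsPayoffBasedPlay [∀ i, FiniteDimensional ℝ (E i)]
    (A : ∀ i, Set (E i)) (u : ℕ → Ω → ι → PiLp 2 E → ℝ)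
    (b : ∀ i, Module.Basis (Fin (d i)) ℝ (E i))
    (h : ∀ i, E i → ℝ) (grad : ∀ i, E i → StrongDual ℝ (E i))
    (base : ∀ i, E i) (r : ι → ℝ) (γ δ : ℕ → ℝ)
    (w : ℕ → Ω → ∀ i, Direction (d i)) (X Xhat : ℕ → Ω → PiLp 2 E) : Prop where
  init : ∀ ω i, X 0 ω i ∈ A i ∧ IsMinOn (h i) (A i) (X 0 ω i)
  play : ∀ n ω i, Xhat n ω i = query (b i) (base i) (r i) (δ n) (X n ω i) (w n ω i)
  update : ∀ n ω i, IsProx (A i) (h i) (grad i) (X n ω i)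
    (γ n • spsaEstimate (b i) (δ n) (u n ω i (Xhat n ω)) (w n ω i)) (X (n + 1) ω i)

end Play

end PayoffLearning

end

open PayoffLearning

namespace PayoffLearning

section ProductSpace

variable {ι : Type*} [Fintype ι] {E : ι → Type*} [∀ i, NormedAddCommGroup (E i)]

lemma norm_le_sum_norm_apply (x : PiLp 2 E) : ‖x‖ ≤ ∑ i, ‖x i‖ := by
  classical
  have hx : x = ∑ i, PiLp.single 2 i (x i) := by
    ext j
    simp [WithLp.ofLp_sum, Finset.sum_apply, Finset.sum_pi_single]
  calc ‖x‖ = ‖∑ i, PiLp.single 2 i (x i)‖ := by rw [← hx]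
    _ ≤ ∑ i, ‖PiLp.single 2 i (x i)‖ := norm_sum_le _ _
    _ = ∑ i, ‖x i‖ := by simp only [PiLp.norm_single]

variable [∀ i, NormedSpace ℝ (E i)]

lemma abs_pairing_le (v : PiLp 2 (fun i => StrongDual ℝ (E i))) (x : PiLp 2 E) :
    |pairing v x| ≤ (∑ i, ‖v i‖) * ‖x‖ := by
  unfold pairing
  rw [Finset.sum_mul]
  refine (Finset.abs_sum_le_sum_abs _ _).trans (Finset.sum_le_sum fun i _ => ?_)
  rw [← Real.norm_eq_abs]
  exact ((v i).le_opNorm _).trans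
    (mul_le_mul_of_nonneg_left (PiLp.norm_apply_le x i) (norm_nonneg _))

lemma pairing_sub_left (v v' : PiLp 2 (fun i => StrongDual ℝ (E i))) (x : PiLp 2 E) :
    pairing (v - v') x = pairing v x - pairing v' x := by
  simp [pairing, Finset.sum_sub_distrib]

lemma pairing_smul_right (v : PiLp 2 (fun i => StrongDual ℝ (E i))) (c : ℝ) (x : PiLp 2 E) :
    pairing v (c • x) = c * pairing v x := by
  simp [pairing, Finset.mul_sum]

lemma pairing_neg_right (v : PiLp 2 (fun i => StrongDual ℝ (E i))) (x : PiLp 2 E) :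
    pairing v (-x) = -pairing v x := by
  simp [pairing]

lemma continuous_pairing : Continuous fun z : PiLp 2 (fun i => StrongDual ℝ (E i)) × PiLp 2 E =>
    pairing z.1 z.2 := by
  unfold pairing
  refine continuous_finsetSum _ fun i _ => ?_
  have h1 : Continuous fun z : PiLp 2 (fun i => StrongDual ℝ (E i)) × PiLp 2 E => z.1 i :=
    (PiLp.continuous_apply 2 _ i).comp continuous_fst
  have h2 : Continuous fun z : PiLp 2 (fun i => StrongDual ℝ (E i)) × PiLp 2 E => z.2 i :=
    (PiLp.continuous_apply 2 _ i).comp continuous_snd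
  exact h1.clm_apply h2

end ProductSpace

section ActionSpace

variable {ι : Type*} {E : ι → Type*} {A : ∀ i, Set (E i)}

lemma deviate_apply_same [DecidableEq ι] (x : PiLp 2 E) (i : ι) (y : E i) :
    deviate x i y i = y := by simp [deviate]

lemma deviate_apply_of_ne [DecidableEq ι] (x : PiLp 2 E) {i j : ι} (h : j ≠ i) (y : E i) :
    deviate x i y j = x j := by simp [deviate, h]

lemma deviate_self [DecidableEq ι] (x : PiLp 2 E) (i : ι) : deviate x i (x i) = x := by
  simp [deviate]

lemma deviate_mem [DecidableEq ι] {x : PiLp 2 E} (hx : x ∈ actionSpace A) {i : ι} {y : E i}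
    (hy : y ∈ A i) : deviate x i y ∈ actionSpace A := by
  intro j
  by_cases h : j = i
  · subst h; rwa [deviate_apply_same]
  · rw [deviate_apply_of_ne x h]; exact hx j

variable [∀ i, NormedAddCommGroup (E i)]

lemma isCompact_actionSpace (hA : ∀ i, IsCompact (A i)) : IsCompact (actionSpace A) := by
  have h : actionSpace A = WithLp.toLp 2 '' (Set.univ.pi A) := by
    ext x
    constructor
    · intro hx
      exact ⟨WithLp.ofLp x, fun i _ => hx i, rfl⟩
    · rintro ⟨y, hy, rfl⟩ i
      exact hy i (Set.mem_univ i)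
  rw [h]
  exact (isCompact_univ_pi hA).image (PiLp.continuous_toLp 2 E)

variable [∀ i, NormedSpace ℝ (E i)]

lemma convex_actionSpace (hA : ∀ i, Convex ℝ (A i)) : Convex ℝ (actionSpace A) := by
  intro x hx y hy a b ha hb hab i
  exact hA i (hx i) (hy i) ha hb hab

end ActionSpace

section PayoffGradient

variable {ι : Type*} [DecidableEq ι] {E : ι → Type*}
  [∀ i, NormedAddCommGroup (E i)] [∀ i, NormedSpace ℝ (E i)]
  {A : ∀ i, Set (E i)} {u : ι → PiLp 2 E → ℝ}

/-- The inclusion of the `i`-th factor, as a continuous linear map. -/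
noncomputable def inclusion (E : ι → Type*) [∀ i, NormedAddCommGroup (E i)]
    [∀ i, NormedSpace ℝ (E i)] (i : ι) : E i →L[ℝ] PiLp 2 E :=
  ((PiLp.continuousLinearEquiv 2 ℝ E).symm : (∀ i, E i) →L[ℝ] PiLp 2 E).comp
    (ContinuousLinearMap.single ℝ E i)

lemma inclusion_apply (i : ι) (y : E i) : inclusion E i y = PiLp.single 2 i y := rfl

lemma deviate_eq_add (x : PiLp 2 E) (i : ι) (y : E i) :
    deviate x i y = x + inclusion E i (y - x i) := by
  ext j
  by_cases h : j = i
  · subst h; simp [deviate_apply_same, inclusion_apply]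
  · simp [deviate_apply_of_ne x h, inclusion_apply, h]

variable [Fintype ι]

lemma hasFDerivAt_deviate (x : PiLp 2 E) (i : ι) (y : E i) :
    HasFDerivAt (fun y : E i => deviate x i y) (inclusion E i) y := by
  simp_rw [deviate_eq_add]
  have h := (inclusion E i).hasFDerivAt (x := y - x i)
  exact (h.comp y ((hasFDerivAt_id y).sub_const (x i))).const_add x

lemma IsConcaveGame.differentiableAt (hu : IsConcaveGame A u) (i : ι) {x : PiLp 2 E}
    (hx : x ∈ actionSpace A) : DifferentiableAt ℝ (u i) x := by
  obtain ⟨U, hU, hAU, hc⟩ := hu.contDiff i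
  exact ((hc.differentiableOn one_ne_zero) x (hAU hx)).differentiableAt (hU.mem_nhds (hAU hx))

lemma IsConcaveGame.payoffGradient_eq (hu : IsConcaveGame A u) (i : ι) {x : PiLp 2 E}
    (hx : x ∈ actionSpace A) :
    payoffGradient u x i = (fderiv ℝ (u i) x).comp (inclusion E i) := by
  have h1 := (hu.differentiableAt i hx).hasFDerivAt
  rw [← deviate_self x i] at h1
  have h2 := h1.comp (x i) (hasFDerivAt_deviate x i (x i))
  rw [deviate_self] at h2
  exact h2.fderiv

lemma IsConcaveGame.hasFDerivAt_deviate (hu : IsConcaveGame A u) (x : PiLp 2 E) (i : ι) {y : E i}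
    (hx : deviate x i y ∈ actionSpace A) :
    HasFDerivAt (fun y : E i => u i (deviate x i y)) (payoffGradient u (deviate x i y) i) y := by
  rw [hu.payoffGradient_eq i hx]
  exact (hu.differentiableAt i hx).hasFDerivAt.comp y (PayoffLearning.hasFDerivAt_deviate x i y)

lemma IsConcaveGame.continuousOn_payoff (hu : IsConcaveGame A u) (i : ι) :
    ContinuousOn (u i) (actionSpace A) := fun _ hx =>
  (hu.differentiableAt i hx).continuousAt.continuousWithinAt

lemma IsConcaveGame.continuousOn_payoffGradient (hu : IsConcaveGame A u) :
    ContinuousOn (payoffGradient u) (actionSpace A) := by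
  have h : ∀ i, ContinuousOn (fun x => payoffGradient u x i) (actionSpace A) := by
    intro i
    obtain ⟨U, hU, hAU, hc⟩ := hu.contDiff i
    have h1 : ContinuousOn (fun x => (fderiv ℝ (u i) x).comp (inclusion E i)) (actionSpace A) :=
      ((hc.continuousOn_fderiv_of_isOpen hU le_rfl).mono hAU).clm_comp continuousOn_const
    exact h1.congr fun x hx => hu.payoffGradient_eq i hx
  exact (PiLp.continuous_toLp 2 _).comp_continuousOn (continuousOn_pi.2 h)

lemma hasDerivAt_deviate_segment (hu : IsConcaveGame A u) {x : PiLp 2 E}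
    (hx : x ∈ actionSpace A) (i : ι) (y : E i) :
    HasDerivAt (fun t : ℝ => u i (deviate x i (x i + t • (y - x i))))
      (payoffGradient u x i (y - x i)) 0 := by
  have h2 : HasDerivAt (fun t : ℝ => x i + t • (y - x i)) (y - x i) 0 := by
    simpa using ((hasDerivAt_id (0 : ℝ)).smul_const (y - x i)).const_add (x i)
  have h1 := hu.hasFDerivAt_deviate x i (y := x i + (0 : ℝ) • (y - x i)) (by simpa [deviate_self])
  have h3 := HasFDerivAt.comp_hasDerivAt (l := fun z : E i => u i (deviate x i z)) (0 : ℝ) h1 h2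
  change HasDerivAt (fun t : ℝ => u i (deviate x i (x i + t • (y - x i)))) _ 0 at h3
  simpa [deviate_self] using h3

/-- Nash equilibria solve the variational inequality of the game, player by player. -/
lemma IsNash.payoffGradient_le (hu : IsConcaveGame A u) (hA : ∀ i, Convex ℝ (A i))
    {x : PiLp 2 E} (hx : IsNash A u x) (i : ι) {y : E i} (hy : y ∈ A i) :
    payoffGradient u x i (y - x i) ≤ 0 := by
  have h := hasDerivAt_deviate_segment hu hx.1 i y
  have h' := h.hasDerivWithinAt (s := Set.Ioi 0)
  rw [hasDerivWithinAt_iff_tendsto_slope' (by simp)] at h'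
  refine le_of_tendsto h' ?_
  filter_upwards [Ioo_mem_nhdsGT (zero_lt_one (α := ℝ))] with t ht
  rw [slope_def_field]
  refine div_nonpos_of_nonpos_of_nonneg ?_ (by linarith [ht.1])
  have hm : x i + t • (y - x i) ∈ A i := (hA i).add_smul_sub_mem (hx.1 i) hy ⟨ht.1.le, ht.2.le⟩
  have := hx.2 i _ hm
  simpa [deviate_self] using this

lemma IsNash.pairing_le (hu : IsConcaveGame A u) (hA : ∀ i, Convex ℝ (A i))
    {x : PiLp 2 E} (hx : IsNash A u x) {y : PiLp 2 E} (hy : y ∈ actionSpace A) :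
    pairing (payoffGradient u x) (y - x) ≤ 0 :=
  Finset.sum_nonpos fun i _ => hx.payoffGradient_le hu hA i (hy i)

/-- Solutions of the variational inequality of a concave game are Nash equilibria. -/
lemma IsNash.of_pairing_le (hu : IsConcaveGame A u)
    {x : PiLp 2 E} (hx : x ∈ actionSpace A)
    (h : ∀ y ∈ actionSpace A, pairing (payoffGradient u x) (y - x) ≤ 0) : IsNash A u x := by
  refine ⟨hx, fun i y hy => ?_⟩
  have h1 : payoffGradient u x i (y - x i) ≤ 0 := by
    refine le_trans (le_of_eq ?_) (h _ (deviate_mem hx hy))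
    unfold pairing
    rw [Finset.sum_eq_single i]
    · simp [deviate_apply_same]
    · intro j _ hj
      simp [deviate_apply_of_ne x hj]
    · simp
  refine le_trans ?_ (add_le_of_nonpos_right h1 : u i x + _ ≤ u i x)
  have h' := (hasDerivAt_deviate_segment hu hx i y).hasDerivWithinAt (s := Set.Ioi 0)
  rw [hasDerivWithinAt_iff_tendsto_slope' (by simp)] at h'
  have : u i (deviate x i y) - u i x ≤ payoffGradient u x i (y - x i) := by
    refine ge_of_tendsto h' ?_
    filter_upwards [Ioo_mem_nhdsGT (zero_lt_one (α := ℝ))] with t ht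
    rw [slope_def_field, le_div_iff₀ (by linarith [ht.1])]
    have hc := (hu.concave i x hx).2 (hx i) hy (sub_nonneg.2 ht.2.le) ht.1.le (by ring)
    have he : (1 - t) • x i + t • y = x i + t • (y - x i) := by module
    rw [he] at hc
    simp only [deviate_self, smul_eq_mul, zero_smul, add_zero] at hc ⊢
    nlinarith
  linarith

end PayoffGradient

section Prox

variable {V : Type*} [NormedAddCommGroup V] [NormedSpace ℝ V]
  {C : Set V} {h : V → ℝ} {grad : V → StrongDual ℝ V}

lemma tendsto_dual_apply {α : Type*} {l : Filter α} {f : α → StrongDual ℝ V} {x : α → V}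
    {f₀ : StrongDual ℝ V} {x₀ : V} (hf : Tendsto f l (𝓝 f₀)) (hx : Tendsto x l (𝓝 x₀)) :
    Tendsto (fun a => f a (x a)) l (𝓝 (f₀ x₀)) :=
  (isBoundedBilinearMap_apply.continuous.tendsto (f₀, x₀)).comp (hf.prodMk_nhds hx)

lemma mem_subdifferential_of_isMinOn {g : StrongDual ℝ V} {x : V}
    (hmin : IsMinOn (fun y => h y - g y) C x) : g ∈ subdifferential C h x := by
  intro y hy
  have : h x - g x ≤ h y - g y := hmin hy
  rw [map_sub]; linarith

lemma IsDGF.exists_isMinOn_sub (hh : IsDGF C h grad) (hC : IsCompact C) {f : V → ℝ}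
    (hf : Continuous f) : ∃ x ∈ C, IsMinOn (fun y => h y - f y) C x := by
  have h1 : LowerSemicontinuousOn (fun y => h y + -f y) C :=
    hh.lsc.add ((Continuous.lowerSemicontinuous (f := fun y => -f y) hf.neg).lowerSemicontinuousOn C)
  simpa only [sub_eq_add_neg] using h1.exists_isMinOn hh.nonempty hC

lemma IsDGF.mem_closure_proxDomain [FiniteDimensional ℝ V] (hh : IsDGF C h grad)
    (hC : IsCompact C) {x : V} (hx : x ∈ C) : x ∈ closure (proxDomain C h) := by
  have key : ∀ n : ℕ, ∃ y ∈ C, IsMinOn (fun y => h y - -(n * ‖toEuclidean (y - x)‖ ^ 2)) C y :=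
    fun n => hh.exists_isMinOn_sub hC (f := fun y => -(n * ‖toEuclidean (y - x)‖ ^ 2))
      (by fun_prop)
  choose y hyC hymin using key
  have hdom : ∀ n, y n ∈ proxDomain C h := by
    intro n
    refine ⟨hyC n, (-(2 * n : ℝ)) • (innerSL ℝ (toEuclidean (y n - x))).comp
      (toEuclidean (E := V) : V →L[ℝ] _), fun z hz => ?_⟩
    set a := toEuclidean (y n - x) with ha
    set c := toEuclidean (z - y n) with hc
    have hval : ((-(2 * n : ℝ)) • (innerSL ℝ a).comp (toEuclidean (E := V) : V →L[ℝ] _)) (z - y n)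
        = -(2 * n) * inner ℝ a c := by
      simp [hc]
    rw [hval]
    have hseg : ∀ t ∈ Set.Ioo (0 : ℝ) 1,
        h (y n) + -(2 * n) * inner ℝ a c ≤ h z + t * (n * ‖c‖ ^ 2) := by
      intro t ht
      have hm : y n + t • (z - y n) ∈ C :=
        hh.convex.1.add_smul_sub_mem (hyC n) hz ⟨ht.1.le, ht.2.le⟩
      have h1 : h (y n) - -(n * ‖toEuclidean (y n - x)‖ ^ 2) ≤
        h (y n + t • (z - y n)) - -(n * ‖toEuclidean (y n + t • (z - y n) - x)‖ ^ 2) := hymin n hm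
      have h2 := hh.convex.2 (hyC n) hz (sub_nonneg.2 ht.2.le) ht.1.le (by ring)
      have he : (1 - t) • y n + t • z = y n + t • (z - y n) := by module
      have he2 : toEuclidean (y n + t • (z - y n) - x) = a + t • c := by
        rw [ha, hc, ← map_smul, ← map_add]; congr 1; abel
      rw [he] at h2
      rw [he2, norm_add_sq_real, norm_smul, inner_smul_right, mul_pow, Real.norm_eq_abs,
        sq_abs] at h1
      simp only [smul_eq_mul] at h2
      have h3 : t * (h (y n) + -(2 * n) * inner ℝ a c) ≤ t * (h z + t * (n * ‖c‖ ^ 2)) := by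
        nlinarith
      exact le_of_mul_le_mul_left h3 ht.1
    have hlim : Tendsto (fun t : ℝ => h z + t * (n * ‖c‖ ^ 2)) (𝓝[>] 0) (𝓝 (h z)) := by
      have : Continuous fun t : ℝ => h z + t * (n * ‖c‖ ^ 2) := by fun_prop
      have h4 := (this.tendsto 0).mono_left (nhdsWithin_le_nhds (s := Set.Ioi 0))
      simpa using h4
    refine ge_of_tendsto hlim ?_
    filter_upwards [Ioo_mem_nhdsGT (zero_lt_one (α := ℝ))] with t ht using hseg t ht
  obtain ⟨x₀, -, hx₀⟩ := hh.exists_isMinOn_sub hC (f := fun _ => 0) continuous_const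
  have hbd : ∀ n : ℕ, n * ‖toEuclidean (y n - x)‖ ^ 2 ≤ h x - h x₀ := by
    intro n
    have h1 : h (y n) - -(n * ‖toEuclidean (y n - x)‖ ^ 2) ≤
      h x - -(n * ‖toEuclidean (x - x)‖ ^ 2) := hymin n hx
    have h2 : h x₀ - 0 ≤ h (y n) - 0 := hx₀ (hyC n)
    rw [sub_self, map_zero, norm_zero] at h1
    linarith
  have hsq : Tendsto (fun n => ‖toEuclidean (y n - x)‖ ^ 2) atTop (𝓝 0) := by
    refine tendsto_of_tendsto_of_tendsto_of_le_of_le' tendsto_const_nhds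
      (tendsto_const_div_atTop_nhds_zero_nat (h x - h x₀)) (Eventually.of_forall fun n => by
        positivity) ?_
    filter_upwards [eventually_gt_atTop 0] with n hn
    rw [le_div_iff₀ (by exact_mod_cast hn), mul_comm]
    exact hbd n
  have h0 : Tendsto (fun n => toEuclidean (y n - x)) atTop (𝓝 0) := by
    rw [tendsto_zero_iff_norm_tendsto_zero]
    have := hsq.sqrt
    simpa using this
  have h1 : Tendsto (fun n => y n - x) atTop (𝓝 0) := by
    have := ((toEuclidean (E := V)).symm.continuous.tendsto 0).comp h0
    simpa [Function.comp_def] using this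
  have h2 : Tendsto y atTop (𝓝 x) := by simpa using h1.add_const x
  exact mem_closure_of_tendsto h2 (Eventually.of_forall hdom)

lemma IsLipschitzDGF.proxDomain_eq [FiniteDimensional ℝ V] (hh : IsLipschitzDGF C h grad)
    (hC : IsCompact C) : proxDomain C h = C := by
  refine Set.Subset.antisymm (fun x hx => hx.1) fun x hx => ⟨hx, ?_⟩
  obtain ⟨hd, M, hM⟩ := hh
  obtain ⟨y, hy, hyx⟩ := mem_closure_iff_seq_limit.1 (hd.mem_closure_proxDomain hC hx)
  obtain ⟨g, -, k, hk, hg⟩ := (isCompact_closedBall (0 : StrongDual ℝ V) M).tendsto_subseq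
    (x := fun n => grad (y n)) (fun n => by simpa using hM _ (hy n))
  have hyk := hyx.comp hk.tendsto_atTop
  refine ⟨g, fun z hz => ?_⟩
  have hlin : Tendsto (fun n => grad (y (k n)) (z - y (k n))) atTop (𝓝 (g (z - x))) :=
    tendsto_dual_apply hg (hyk.const_sub z)
  suffices H : ∀ a < h x, a ≤ h z - g (z - x) by
    have := le_of_forall_lt_imp_le_of_dense H
    linarith
  intro a ha
  have hw : Tendsto (y ∘ k) atTop (𝓝[C] x) :=
    tendsto_nhdsWithin_iff.2 ⟨hyk, Eventually.of_forall fun n => (hy (k n)).1⟩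
  have hev := hw.eventually (hd.lsc x hx a ha)
  refine ge_of_tendsto (hlin.const_sub (h z)) ?_
  filter_upwards [hev] with n hn
  have := hd.grad_mem _ (hy (k n)) z hz
  simp only [Function.comp] at hn
  linarith

lemma IsProx.isMinOn {x x' : V} {v : StrongDual ℝ V} (h' : IsProx C h grad x v x') :
    IsMinOn (fun y => h y - (grad x + v) y) C x' := by
  intro y hy
  have h1 : v (x - x') + bregman h grad x' x ≤ v (x - y) + bregman h grad y x := h'.2 hy
  simp only [bregman, map_sub] at h1
  simp only [Set.mem_ofPred_eq, add_apply]
  linarith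

lemma IsDGF.exists_isProx (hh : IsDGF C h grad) (hC : IsCompact C) (x : V)
    (v : StrongDual ℝ V) : ∃ x', IsProx C h grad x v x' := by
  obtain ⟨x', hx', hmin⟩ := hh.exists_isMinOn_sub hC (grad x + v).continuous
  refine ⟨x', hx', fun y hy => ?_⟩
  have h1 : h x' - (grad x + v) x' ≤ h y - (grad x + v) y := hmin hy
  simp only [add_apply] at h1
  simp only [Set.mem_ofPred_eq, bregman, map_sub]
  linarith

lemma bregman_self (x : V) : bregman h grad x x = 0 := by simp [bregman]

variable [FiniteDimensional ℝ V]

/-- The continuous selection dominates every subgradient along feasible directions. -/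
lemma IsLipschitzDGF.apply_le_grad (hh : IsLipschitzDGF C h grad) (hC : IsCompact C)
    {x p : V} (hx : x ∈ C) (hp : p ∈ C) {g : StrongDual ℝ V} (hg : g ∈ subdifferential C h x) :
    g (p - x) ≤ grad x (p - x) := by
  have hdom := hh.proxDomain_eq hC
  have hcont := hh.1.grad_continuous
  rw [hdom] at hcont
  have hm : ∀ t ∈ Set.Ioo (0 : ℝ) 1, x + t • (p - x) ∈ C := fun t ht =>
    hh.1.convex.1.add_smul_sub_mem hx hp ⟨ht.1.le, ht.2.le⟩
  have hlim : Tendsto (fun t : ℝ => x + t • (p - x)) (𝓝[>] 0) (𝓝[C] x) := by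
    refine tendsto_nhdsWithin_iff.2 ⟨?_, ?_⟩
    · have : Continuous fun t : ℝ => x + t • (p - x) := by fun_prop
      have h4 := (this.tendsto 0).mono_left (nhdsWithin_le_nhds (s := Set.Ioi 0))
      simpa using h4
    · filter_upwards [Ioo_mem_nhdsGT (zero_lt_one (α := ℝ))] with t ht using hm t ht
  have hlim2 := tendsto_dual_apply ((hcont x hx).tendsto.comp hlim) (tendsto_const_nhds (x := p - x))
  refine ge_of_tendsto hlim2 ?_
  filter_upwards [Ioo_mem_nhdsGT (zero_lt_one (α := ℝ))] with t ht
  have h1 := hh.1.grad_mem _ (hdom.symm ▸ hm t ht : x + t • (p - x) ∈ proxDomain C h) x hx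
  have h2 := hg _ (hm t ht)
  have e1 : x - (x + t • (p - x)) = -(t • (p - x)) := by abel
  have e2 : x + t • (p - x) - x = t • (p - x) := by abel
  rw [e1, map_neg, map_smul, smul_eq_mul] at h1
  rw [e2, map_smul, smul_eq_mul] at h2
  have h3 : t * g (p - x) ≤ t * grad (x + t • (p - x)) (p - x) := by linarith
  exact le_of_mul_le_mul_left h3 ht.1

/-- The mirror map `g ↦ argmin_{y ∈ C} {h y - g y}` is well defined and continuous. -/
lemma IsLipschitzDGF.exists_mirrorMap (hh : IsLipschitzDGF C h grad) (hC : IsCompact C) :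
    ∃ Q : StrongDual ℝ V → V, Continuous Q ∧
      ∀ g, ∀ x ∈ C, IsMinOn (fun y => h y - g y) C x → x = Q g := by
  obtain ⟨K, hK, hsc⟩ := hh.1.strong_convex
  rw [hh.proxDomain_eq hC] at hsc
  have key : ∀ g₁ g₂ : StrongDual ℝ V, ∀ x₁ ∈ C, ∀ x₂ ∈ C, IsMinOn (fun y => h y - g₁ y) C x₁ →
      IsMinOn (fun y => h y - g₂ y) C x₂ → K * ‖x₁ - x₂‖ ≤ ‖g₁ - g₂‖ := by
    intro g₁ g₂ x₁ hx₁ x₂ hx₂ h₁ h₂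
    have a1 := hh.apply_le_grad hC hx₁ hx₂ (mem_subdifferential_of_isMinOn h₁)
    have a2 := hh.apply_le_grad hC hx₂ hx₁ (mem_subdifferential_of_isMinOn h₂)
    have b1 := hsc x₁ hx₁ x₂ hx₂
    have b2 := hsc x₂ hx₂ x₁ hx₁
    have e : g₂ (x₁ - x₂) = -g₂ (x₂ - x₁) := by rw [← map_neg, neg_sub]
    have c1 : g₁ (x₂ - x₁) + g₂ (x₁ - x₂) = -((g₁ - g₂) (x₁ - x₂)) := by
      simp only [sub_apply, map_sub]; ring
    have c2 := (le_abs_self _).trans ((g₁ - g₂).le_opNorm (x₁ - x₂))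
    rw [norm_sub_rev x₂ x₁] at b1
    rcases (norm_nonneg (x₁ - x₂)).eq_or_lt with h0 | h0
    · rw [← h0, mul_zero]; positivity
    · refine le_of_mul_le_mul_right ?_ h0
      nlinarith
  have ex : ∀ g : StrongDual ℝ V, ∃ x ∈ C, IsMinOn (fun y => h y - g y) C x := fun g =>
    hh.1.exists_isMinOn_sub hC g.continuous
  choose Q hQ hmin using ex
  refine ⟨Q, ?_, fun g x hx hxm => ?_⟩
  · refine (LipschitzWith.of_dist_le_mul (K := (K⁻¹).toNNReal) fun g₁ g₂ => ?_).continuous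
    rw [dist_eq_norm, dist_eq_norm, Real.coe_toNNReal _ (inv_nonneg.2 hK.le), inv_mul_eq_div,
      le_div_iff₀ hK, mul_comm]
    exact key g₁ g₂ _ (hQ _) _ (hQ _) (hmin _) (hmin _)
  · have := key g g x hx (Q g) (hQ g) hxm (hmin g)
    rw [sub_self, norm_zero] at this
    have h1 : ‖x - Q g‖ ≤ 0 := by
      by_contra! h0
      nlinarith [mul_pos hK h0]
    exact sub_eq_zero.1 (norm_le_zero_iff.1 h1)

/-- The energy inequality of a prox-step. -/
lemma IsLipschitzDGF.bregman_prox_le (hh : IsLipschitzDGF C h grad) (hC : IsCompact C) {K : ℝ}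
    (hK : 0 < K)
    (hsc : ∀ x ∈ C, ∀ y ∈ C, h x + grad x (y - x) + K / 2 * ‖y - x‖ ^ 2 ≤ h y)
    {x x' p : V} (hx : x ∈ C) (hp : p ∈ C) {v : StrongDual ℝ V} (h' : IsProx C h grad x v x') :
    bregman h grad p x' ≤ bregman h grad p x + v (x - p) + ‖v‖ ^ 2 / (2 * K) := by
  have a := hh.apply_le_grad hC h'.1 hp (mem_subdifferential_of_isMinOn h'.isMinOn)
  have b := hsc x hx x' h'.1
  have c := (le_abs_self _).trans (v.le_opNorm (x' - x))
  have e : ‖v‖ * ‖x' - x‖ ≤ K / 2 * ‖x' - x‖ ^ 2 + ‖v‖ ^ 2 / (2 * K) := by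
    have h1 : 0 ≤ (K * ‖x' - x‖ - ‖v‖) ^ 2 / (2 * K) := by positivity
    have h2 : (K * ‖x' - x‖ - ‖v‖) ^ 2 / (2 * K) =
        K / 2 * ‖x' - x‖ ^ 2 + ‖v‖ ^ 2 / (2 * K) - ‖v‖ * ‖x' - x‖ := by
      field_simp; ring
    linarith
  simp only [bregman, map_sub, add_apply] at *
  linarith

lemma IsLipschitzDGF.bregman_sub_le (hh : IsLipschitzDGF C h grad) (hC : IsCompact C) {M : ℝ}
    (hM : ∀ x ∈ C, ‖grad x‖ ≤ M) {x p p' : V} (hx : x ∈ C) (hp : p ∈ C) (hp' : p' ∈ C) :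
    bregman h grad p' x ≤ bregman h grad p x + 2 * M * ‖p' - p‖ := by
  have a := hh.1.grad_mem p' (by rwa [hh.proxDomain_eq hC]) p hp
  have b : grad p' (p' - p) ≤ M * ‖p' - p‖ := (le_abs_self _).trans
    (((grad p').le_opNorm _).trans (mul_le_mul_of_nonneg_right (hM _ hp') (norm_nonneg _)))
  have c : -grad x (p' - p) ≤ M * ‖p' - p‖ := (neg_le_abs _).trans
    (((grad x).le_opNorm _).trans (mul_le_mul_of_nonneg_right (hM _ hx) (norm_nonneg _)))
  simp only [bregman, map_sub] at *
  linarith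

end Prox

section Directions

variable {V : Type*} [NormedAddCommGroup V] [NormedSpace ℝ V] {d : ℕ}

lemma dirVec_not (b : Module.Basis (Fin d) ℝ V) (e : Direction d) :
    dirVec b (e.1, !e.2) = -dirVec b e := by
  rcases e with ⟨k, s⟩
  cases s <;> simp [dirVec]

variable [FiniteDimensional ℝ V]

lemma dirCovec_not (b : Module.Basis (Fin d) ℝ V) (e : Direction d) :
    dirCovec b (e.1, !e.2) = -dirCovec b e := by
  rcases e with ⟨k, s⟩
  cases s <;> simp [dirCovec]

/-- The sampling directions form a tight frame. -/
lemma sum_apply_dirVec_smul_dirCovec (b : Module.Basis (Fin d) ℝ V) (φ : StrongDual ℝ V) :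
    ∑ e : Direction d, φ (dirVec b e) • dirCovec b e = (2 : ℝ) • φ := by
  ext x
  have hx : ∑ k, φ (b k) * b.repr x k = φ x := by
    conv_rhs => rw [← b.sum_repr x, map_sum]
    exact Finset.sum_congr rfl fun k _ => by rw [map_smul, smul_eq_mul, mul_comm]
  rw [Fintype.sum_prod_type]
  simp only [Fintype.sum_bool, dirVec, dirCovec]
  simp only [if_true, Bool.false_eq_true, if_false, map_neg, smul_neg, neg_smul, neg_neg]
  simp only [← two_smul ℝ, ← Finset.smul_sum]
  simp [hx]

end Directions

lemma sum_pi_apply {ι : Type*} [Fintype ι] [DecidableEq ι] {α : ι → Type*} [∀ i, Fintype (α i)]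
    [∀ i, DecidableEq (α i)] [Nonempty (∀ i, α i)]
    {F : Type*} [AddCommGroup F] [Module ℝ F] (i : ι) (f : α i → F) :
    (Fintype.card (∀ i, α i) : ℝ)⁻¹ • ∑ e : ∀ i, α i, f (e i) =
      (Fintype.card (α i) : ℝ)⁻¹ • ∑ a, f a := by
  have h1 : ∑ e : ∀ i, α i, f (e i) =
      ∑ z : α i × (∀ j : {j // j ≠ i}, α j), f z.1 :=
    Fintype.sum_equiv (Equiv.piSplitAt i α) _ _ fun e => rfl
  have h2 := Fintype.card_congr (Equiv.piSplitAt i α)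
  have h3 : (Fintype.card (∀ i, α i) : ℝ) ≠ 0 := by
    exact_mod_cast Fintype.card_ne_zero
  rw [h1, Fintype.sum_prod_type]
  rw [h2] at h3 ⊢
  rw [Fintype.card_prod] at h3 ⊢
  push_cast at h3 ⊢
  simp only [Finset.sum_const, Finset.card_univ, ← Finset.smul_sum, ← Nat.cast_smul_eq_nsmul ℝ]
  rw [smul_smul]
  congr 1
  have h4 := right_ne_zero_of_mul h3
  field_simp

section Estimate

variable {ι : Type*} {E : ι → Type*}
  [∀ i, NormedAddCommGroup (E i)] [∀ i, NormedSpace ℝ (E i)] {d : ι → ℕ}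

/-- The profile of realized actions when the players draw the directions `e`. -/
noncomputable def queryProfile (b : ∀ i, Module.Basis (Fin (d i)) ℝ (E i)) (base : ∀ i, E i)
    (r : ι → ℝ) (δ : ℝ) (x : PiLp 2 E) (e : ∀ i, Direction (d i)) : PiLp 2 E :=
  WithLp.toLp 2 fun i => query (b i) (base i) (r i) δ (x i) (e i)

/-- A displacement of the contracted profile by `s i` along the direction of player `i`. -/
noncomputable def shiftProfile (b : ∀ i, Module.Basis (Fin (d i)) ℝ (E i)) (base : ∀ i, E i)
    (r : ι → ℝ) (δ : ℝ) (x : PiLp 2 E) (e : ∀ i, Direction (d i)) (s : ι → ℝ) : PiLp 2 E :=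
  WithLp.toLp 2 fun i =>
    (1 - δ / r i) • x i + (δ / r i) • base i + s i • dirVec (b i) (e i)

/-- The profile of gradient estimates when the players draw the directions `e`. -/
noncomputable def estimateProfile [∀ i, FiniteDimensional ℝ (E i)]
    (b : ∀ i, Module.Basis (Fin (d i)) ℝ (E i)) (base : ∀ i, E i)
    (r : ι → ℝ) (δ : ℝ) (u : ι → PiLp 2 E → ℝ) (x : PiLp 2 E) (e : ∀ i, Direction (d i)) :
    PiLp 2 (fun i => StrongDual ℝ (E i)) :=
  WithLp.toLp 2 fun i => spsaEstimate (b i) δ (u i (queryProfile b base r δ x e)) (e i)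

variable {A : ∀ i, Set (E i)} {b : ∀ i, Module.Basis (Fin (d i)) ℝ (E i)} {base : ∀ i, E i}
  {r : ι → ℝ} {δ : ℝ}

lemma queryProfile_eq_shiftProfile (hr : ∀ i, 0 < r i) (x : PiLp 2 E)
    (e : ∀ i, Direction (d i)) :
    queryProfile b base r δ x e = shiftProfile b base r δ x e fun _ => δ := by
  ext i
  have := (hr i).ne'
  simp only [queryProfile, shiftProfile, query, smul_add, smul_smul, div_mul_cancel₀ _ this,
    add_assoc]

lemma queryProfile_flip_eq_shiftProfile [DecidableEq ι] (hr : ∀ i, 0 < r i) (x : PiLp 2 E)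
    (e : ∀ i, Direction (d i)) (i : ι) :
    queryProfile b base r δ x (Function.update e i ((e i).1, !(e i).2)) =
      shiftProfile b base r δ x e (Function.update (fun _ => δ) i (-δ)) := by
  rw [queryProfile_eq_shiftProfile hr]
  ext j
  by_cases h : j = i
  · subst h; simp [shiftProfile, dirVec_not]
  · simp [shiftProfile, h]

lemma shiftProfile_update [DecidableEq ι] (x : PiLp 2 E) (e : ∀ i, Direction (d i))
    (s : ι → ℝ) (i : ι) (t : ℝ) :
    shiftProfile b base r δ x e (Function.update s i t) =
      deviate (shiftProfile b base r δ x e s) i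
        ((1 - δ / r i) • x i + (δ / r i) • base i + t • dirVec (b i) (e i)) := by
  ext j
  by_cases h : j = i
  · subst h; simp [shiftProfile, deviate]
  · simp [shiftProfile, deviate, h]

lemma shiftProfile_mem (hA : ∀ i, Convex ℝ (A i)) (hs : IsSafe A b base r) {x : PiLp 2 E}
    (hx : x ∈ actionSpace A) (hδ : 0 < δ) (hδr : ∀ i, δ ≤ r i) (e : ∀ i, Direction (d i))
    {s : ι → ℝ} (hsδ : ∀ i, |s i| ≤ δ) : shiftProfile b base r δ x e s ∈ actionSpace A := by
  intro i
  have hr := hs.radius_pos i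
  have h1 := hs.feasible i (e i)
  have h2 := hs.feasible i ((e i).1, !(e i).2)
  rw [dirVec_not] at h2
  have h3 := abs_le.1 (hsδ i)
  have h4 : base i + (s i * r i / δ) • dirVec (b i) (e i) ∈ A i := by
    have := hA i h1 h2 (a := (1 + s i / δ) / 2) (b := (1 - s i / δ) / 2)
      (by have : -1 ≤ s i / δ := by rw [le_div_iff₀ hδ]; linarith
          linarith)
      (by have : s i / δ ≤ 1 := by rw [div_le_iff₀ hδ]; linarith
          linarith) (by ring)
    convert this using 1
    simp only [smul_add, smul_smul, smul_neg]
    module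
  have h5 := hA i (hx i) h4 (a := 1 - δ / r i) (b := δ / r i)
    (by rw [sub_nonneg, div_le_one hr]; exact hδr i) (by positivity) (by ring)
  convert h5 using 1
  have : δ / r i * (s i * r i / δ) = s i := by field_simp
  simp only [shiftProfile, smul_add, smul_smul, this, add_assoc]

lemma queryProfile_mem (hA : ∀ i, Convex ℝ (A i)) (hs : IsSafe A b base r) {x : PiLp 2 E}
    (hx : x ∈ actionSpace A) (hδ : 0 < δ) (hδr : ∀ i, δ ≤ r i) (e : ∀ i, Direction (d i)) :
    queryProfile b base r δ x e ∈ actionSpace A := by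
  rw [queryProfile_eq_shiftProfile hs.radius_pos]
  exact shiftProfile_mem hA hs hx hδ hδr e fun _ => (abs_of_pos hδ).le

variable [Fintype ι]

lemma exists_norm_shiftProfile_sub_le (hA : ∀ i, IsCompact (A i)) (hs : IsSafe A b base r) :
    ∃ B : ℝ, 0 ≤ B ∧ ∀ x ∈ actionSpace A, ∀ e, ∀ δ : ℝ, 0 < δ → ∀ s : ι → ℝ, (∀ i, |s i| ≤ δ) →
      ‖shiftProfile b base r δ x e s - x‖ ≤ B * δ := by
  obtain ⟨R, hR⟩ := (isCompact_actionSpace hA).isBounded.exists_norm_le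
  have hbase : (WithLp.toLp 2 base : PiLp 2 E) ∈ actionSpace A := fun i =>
    interior_subset (hs.base_mem i)
  have hR0 : 0 ≤ R := (norm_nonneg _).trans (hR _ hbase)
  have hr := hs.radius_pos
  refine ⟨∑ i, (2 * R / r i + ∑ a, ‖dirVec (b i) a‖), Finset.sum_nonneg fun i _ => by
    have := hr i; positivity, fun x hx e δ hδ s hsδ => ?_⟩
  refine (norm_le_sum_norm_apply _).trans ?_
  rw [Finset.sum_mul]
  refine Finset.sum_le_sum fun i _ => ?_
  have e1 : (shiftProfile b base r δ x e s - x) i =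
      (δ / r i) • (base i - x i) + s i • dirVec (b i) (e i) := by
    simp only [shiftProfile, PiLp.sub_apply]
    module
  have h1 : ‖base i - x i‖ ≤ 2 * R := by
    have h2 := PiLp.norm_apply_le ((WithLp.toLp 2 base : PiLp 2 E) - x) i
    have h3 := (norm_sub_le (WithLp.toLp 2 base : PiLp 2 E) x).trans
      (add_le_add (hR _ hbase) (hR _ hx))
    have h4 : ((WithLp.toLp 2 base : PiLp 2 E) - x) i = base i - x i := rfl
    rw [h4] at h2
    linarith
  have h2 : ‖dirVec (b i) (e i)‖ ≤ ∑ a, ‖dirVec (b i) a‖ :=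
    Finset.single_le_sum (f := fun a => ‖dirVec (b i) a‖) (fun _ _ => norm_nonneg _)
      (Finset.mem_univ _)
  rw [e1]
  have hri := hr i
  calc _ ≤ ‖(δ / r i) • (base i - x i)‖ + ‖s i • dirVec (b i) (e i)‖ := norm_add_le _ _
    _ = δ / r i * ‖base i - x i‖ + |s i| * ‖dirVec (b i) (e i)‖ := by
      rw [norm_smul, norm_smul, Real.norm_eq_abs, Real.norm_eq_abs,
        abs_of_pos (div_pos hδ hri)]
    _ ≤ δ / r i * (2 * R) + δ * ∑ a, ‖dirVec (b i) a‖ := by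
      gcongr
      exact hsδ i
    _ = _ := by ring

variable [∀ i, FiniteDimensional ℝ (E i)]

/-- Averaging the estimate over a flip of the direction of player `i` yields a directional
derivative at a nearby profile. -/
lemma exists_spsaEstimate_add_flip [DecidableEq ι] (hA : ∀ i, Convex ℝ (A i))
    (hs : IsSafe A b base r)
    {u : ι → PiLp 2 E → ℝ} (hu : IsConcaveGame A u) {x : PiLp 2 E} (hx : x ∈ actionSpace A)
    (hδ : 0 < δ) (hδr : ∀ i, δ ≤ r i) (e : ∀ i, Direction (d i)) (i : ι) :
    ∃ s : ι → ℝ, (∀ j, |s j| ≤ δ) ∧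
      estimateProfile b base r δ u x e i +
        estimateProfile b base r δ u x (Function.update e i ((e i).1, !(e i).2)) i =
      (2 : ℝ) • (d i : ℝ) • payoffGradient u (shiftProfile b base r δ x e s) i
        (dirVec (b i) (e i)) • dirCovec (b i) (e i) := by
  set S : ℝ → ι → ℝ := fun t => Function.update (fun _ => δ) i t with hS
  set φ : ℝ → ℝ := fun t => u i (shiftProfile b base r δ x e (S t)) with hφ
  have hSδ : ∀ t, |t| ≤ δ → ∀ j, |S t j| ≤ δ := by
    intro t ht j
    by_cases h : j = i
    · subst h; simpa [hS] using ht
    · simp [hS, h, abs_of_pos hδ]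
  have hmem : ∀ t, |t| ≤ δ → shiftProfile b base r δ x e (S t) ∈ actionSpace A := fun t ht =>
    shiftProfile_mem hA hs hx hδ hδr e (hSδ t ht)
  have hderiv : ∀ t, |t| ≤ δ → HasDerivAt φ
      (payoffGradient u (shiftProfile b base r δ x e (S t)) i (dirVec (b i) (e i))) t := by
    intro t ht
    have h2 : HasDerivAt (fun t : ℝ => (1 - δ / r i) • x i + (δ / r i) • base i +
        t • dirVec (b i) (e i)) (dirVec (b i) (e i)) t := by
      simpa using ((hasDerivAt_id t).smul_const (dirVec (b i) (e i))).const_add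
        ((1 - δ / r i) • x i + (δ / r i) • base i)
    have h0 := hmem t ht
    simp only [hS, shiftProfile_update] at h0
    have h1 := hu.hasFDerivAt_deviate (shiftProfile b base r δ x e fun _ => δ) i h0
    have h3 := HasFDerivAt.comp_hasDerivAt (l := fun z : E i => u i
      (deviate (shiftProfile b base r δ x e fun _ => δ) i z)) t h1 h2
    simp only [hφ, hS, shiftProfile_update]
    exact h3
  obtain ⟨t, ht, hslope⟩ := exists_hasDerivAt_eq_slope φ
    (fun t => payoffGradient u (shiftProfile b base r δ x e (S t)) i (dirVec (b i) (e i)))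
    (by linarith : -δ < δ)
    (fun t ht => (hderiv t (abs_le.2 ht)).continuousAt.continuousWithinAt)
    (fun t ht => hderiv t (abs_le.2 ⟨ht.1.le, ht.2.le⟩))
  refine ⟨S t, hSδ t (abs_le.2 ⟨ht.1.le, ht.2.le⟩), ?_⟩
  rw [hslope]
  have hSδδ : Function.update (fun _ : ι => δ) i δ = fun _ => δ := by simp
  simp only [estimateProfile, spsaEstimate, Function.update_self, dirCovec_not,
    queryProfile_flip_eq_shiftProfile hs.radius_pos, queryProfile_eq_shiftProfile hs.radius_pos, hφ,
    hSδδ, hS]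
  ext z
  simp only [smul_neg, add_apply, neg_apply, smul_apply, smul_eq_mul]
  field_simp
  ring

/-- The bias of the single-point gradient estimate is of the order of the sampling radius. -/
lemma exists_estimateProfile_bias_le [DecidableEq ι] (hA : ∀ i, IsCompact (A i))
    (hAc : ∀ i, Convex ℝ (A i)) (hs : IsSafe A b base r) [Nonempty (∀ i, Direction (d i))] (L : ℝ) (hL : 0 ≤ L) :
    ∃ B : ℝ, 0 ≤ B ∧ ∀ u : ι → PiLp 2 E → ℝ, IsConcaveGame A u →
      (∀ x ∈ actionSpace A, ∀ x' ∈ actionSpace A,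
        ‖payoffGradient u x' - payoffGradient u x‖ ≤ L * ‖x' - x‖) →
      ∀ δ : ℝ, 0 < δ → (∀ i, δ ≤ r i) → ∀ x ∈ actionSpace A, ∀ i,
        ‖(Fintype.card (∀ i, Direction (d i)) : ℝ)⁻¹ • ∑ e, estimateProfile b base r δ u x e i -
          payoffGradient u x i‖ ≤ B * δ := by
  obtain ⟨B, hB0, hB⟩ := exists_norm_shiftProfile_sub_le (b := b) hA hs
  set N : ℝ := ((Fintype.card (∀ i, Direction (d i)) : ℕ) : ℝ) with hN
  have hN0 : 0 < N := by rw [hN]; exact_mod_cast Fintype.card_pos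
  set K : ι → ℝ := fun i => (d i : ℝ) * (∑ a, ‖dirVec (b i) a‖) * ∑ a, ‖dirCovec (b i) a‖ with hK
  have hK0 : ∀ i, 0 ≤ K i := fun i => by positivity
  refine ⟨∑ i, K i * (L * B), Finset.sum_nonneg fun i _ => by have := hK0 i; positivity,
    fun u hu huL δ hδ hδr x hx i => ?_⟩
  choose s hsδ hsum using fun e => exists_spsaEstimate_add_flip hAc hs hu hx hδ hδr e i
  set v := payoffGradient u x i with hv
  set f : (∀ i, Direction (d i)) → StrongDual ℝ (E i) := fun e =>
    estimateProfile b base r δ u x e i with hf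
  set flip : (∀ i, Direction (d i)) → (∀ i, Direction (d i)) := fun e =>
    Function.update e i ((e i).1, !(e i).2) with hflip
  have hinv : Function.Involutive flip := fun e => by simp [hflip]
  have h1 : ∑ e, f (flip e) = ∑ e, f e := Equiv.sum_comp hinv.toPerm f
  have h2 : ∑ e, f e = ∑ e, (d i : ℝ) • payoffGradient u (shiftProfile b base r δ x e (s e)) i
        (dirVec (b i) (e i)) • dirCovec (b i) (e i) := by
    have h3 : (2 : ℝ) • ∑ e, f e = (2 : ℝ) • ∑ e, (d i : ℝ) •
        payoffGradient u (shiftProfile b base r δ x e (s e)) i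
        (dirVec (b i) (e i)) • dirCovec (b i) (e i) := by
      have h4 : (2 : ℝ) • ∑ e, f e = ∑ e, (f e + f (flip e)) := by
        rw [Finset.sum_add_distrib, h1, two_smul]
      rw [h4, Finset.smul_sum]
      exact Finset.sum_congr rfl fun e _ => hsum e
    exact smul_right_injective _ (two_ne_zero (α := ℝ)) h3
  have hdi : (d i : ℝ) ≠ 0 := by
    obtain ⟨e⟩ := ‹Nonempty (∀ i, Direction (d i))›
    have := (e i).1.pos
    exact_mod_cast this.ne'
  have h4 : v = N⁻¹ • ∑ e : ∀ i, Direction (d i),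
      (d i : ℝ) • v (dirVec (b i) (e i)) • dirCovec (b i) (e i) := by
    rw [hN, sum_pi_apply (α := fun i => Direction (d i)) i
        (fun a => (d i : ℝ) • v (dirVec (b i) a) • dirCovec (b i) a),
      ← Finset.smul_sum, sum_apply_dirVec_smul_dirCovec, smul_smul, smul_smul]
    simp only [Fintype.card_prod, Fintype.card_fin, Fintype.card_bool, Nat.cast_mul]
    rw [show ((d i : ℝ) * (2 : ℕ))⁻¹ * d i * 2 = 1 by push_cast; field_simp, one_smul]
  have h5 : N⁻¹ • ∑ e, f e - v = N⁻¹ • ∑ e : ∀ i, Direction (d i), (d i : ℝ) •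
      ((payoffGradient u (shiftProfile b base r δ x e (s e)) i - v) (dirVec (b i) (e i))) •
        dirCovec (b i) (e i) := by
    rw [h2]
    refine (congrArg (_ - ·) h4).trans ((smul_sub _ _ _).symm.trans ?_)
    rw [← Finset.sum_sub_distrib]
    refine congrArg _ (Finset.sum_congr rfl fun e _ => ?_)
    ext z
    simp only [sub_apply, smul_apply, smul_eq_mul]
    ring
  have h6 : ∀ e : ∀ i, Direction (d i), ‖(d i : ℝ) •
      ((payoffGradient u (shiftProfile b base r δ x e (s e)) i - v) (dirVec (b i) (e i))) •
        dirCovec (b i) (e i)‖ ≤ K i * (L * B) * δ := by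
    intro e
    have hmem := shiftProfile_mem hAc hs hx hδ hδr e (hsδ e)
    have a1 : ‖payoffGradient u (shiftProfile b base r δ x e (s e)) i - v‖ ≤ L * (B * δ) :=
      (PiLp.norm_apply_le (payoffGradient u (shiftProfile b base r δ x e (s e)) -
        payoffGradient u x) i).trans ((huL _ hx _ hmem).trans
          (mul_le_mul_of_nonneg_left (hB x hx e δ hδ _ (hsδ e)) hL))
    have a2 : ‖dirVec (b i) (e i)‖ ≤ ∑ a, ‖dirVec (b i) a‖ :=
      Finset.single_le_sum (f := fun a => ‖dirVec (b i) a‖) (fun _ _ => norm_nonneg _)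
        (Finset.mem_univ _)
    have a3 : ‖dirCovec (b i) (e i)‖ ≤ ∑ a, ‖dirCovec (b i) a‖ :=
      Finset.single_le_sum (f := fun a => ‖dirCovec (b i) a‖) (fun _ _ => norm_nonneg _)
        (Finset.mem_univ _)
    rw [norm_smul, norm_smul, Real.norm_natCast]
    calc _ ≤ (d i : ℝ) * ((L * (B * δ) * ∑ a, ‖dirVec (b i) a‖) * ∑ a, ‖dirCovec (b i) a‖) := by
          gcongr
          exact ((ContinuousLinearMap.le_opNorm _ _).trans (by gcongr))
      _ = _ := by rw [hK]; ring
  rw [show (N⁻¹ • ∑ e, estimateProfile b base r δ u x e i - v) = N⁻¹ • ∑ e, f e - v from rfl, h5,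
    norm_smul, norm_inv, Real.norm_of_nonneg hN0.le, inv_mul_le_iff₀ hN0]
  refine (norm_sum_le _ _).trans ((Finset.sum_le_sum fun e _ => h6 e).trans ?_)
  rw [Finset.sum_const, Finset.card_univ, nsmul_eq_mul, ← hN]
  gcongr
  exact Finset.single_le_sum (f := fun i => K i * (L * B))
    (fun i _ => by have := hK0 i; positivity) (Finset.mem_univ i)

/-- The estimates are at most of the order of the inverse sampling radius. -/
lemma exists_norm_estimateProfile_le (hAc : ∀ i, Convex ℝ (A i)) (hs : IsSafe A b base r)
    (M : ℝ) (hM : 0 ≤ M) :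
    ∃ B : ℝ, 0 ≤ B ∧ ∀ u : ι → PiLp 2 E → ℝ, (∀ i, ∀ x ∈ actionSpace A, |u i x| ≤ M) →
      ∀ δ : ℝ, 0 < δ → (∀ i, δ ≤ r i) → ∀ x ∈ actionSpace A, ∀ e i,
        ‖estimateProfile b base r δ u x e i‖ ≤ B / δ := by
  refine ⟨∑ i, (d i : ℝ) * M * ∑ a, ‖dirCovec (b i) a‖, by positivity,
    fun u hu δ hδ hδr x hx e i => ?_⟩
  have h1 := hu i _ (queryProfile_mem hAc hs hx hδ hδr e)
  have h2 : ‖dirCovec (b i) (e i)‖ ≤ ∑ a, ‖dirCovec (b i) a‖ :=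
    Finset.single_le_sum (f := fun a => ‖dirCovec (b i) a‖) (fun _ _ => norm_nonneg _)
      (Finset.mem_univ _)
  have h3 : (d i : ℝ) * M * ∑ a, ‖dirCovec (b i) a‖ ≤
      ∑ i, (d i : ℝ) * M * ∑ a, ‖dirCovec (b i) a‖ :=
    Finset.single_le_sum (f := fun i => (d i : ℝ) * M * ∑ a, ‖dirCovec (b i) a‖)
      (fun i _ => by positivity) (Finset.mem_univ i)
  simp only [estimateProfile, spsaEstimate]
  rw [norm_smul, Real.norm_eq_abs, abs_mul, abs_of_nonneg (by positivity : 0 ≤ (d i : ℝ) / δ)]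
  calc _ ≤ (d i : ℝ) / δ * M * ∑ a, ‖dirCovec (b i) a‖ := by gcongr
    _ = ((d i : ℝ) * M * ∑ a, ‖dirCovec (b i) a‖) / δ := by ring
    _ ≤ _ := by gcongr

end Estimate

section Energy

variable {ι : Type*} [Fintype ι] {E : ι → Type*}
  [∀ i, NormedAddCommGroup (E i)] [∀ i, NormedSpace ℝ (E i)]
  {A : ∀ i, Set (E i)} {h : ∀ i, E i → ℝ} {grad : ∀ i, E i → StrongDual ℝ (E i)}

/-- The aggregate Bregman divergence of a profile. -/
noncomputable def energy (h : ∀ i, E i → ℝ) (grad : ∀ i, E i → StrongDual ℝ (E i))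
    (p x : PiLp 2 E) : ℝ :=
  ∑ i, bregman (h i) (grad i) (p i) (x i)

lemma energy_self (x : PiLp 2 E) : energy h grad x x = 0 := by
  simp [energy, bregman_self]

variable [∀ i, FiniteDimensional ℝ (E i)]

lemma exists_energy_prox_le (hA : ∀ i, IsCompact (A i))
    (hh : ∀ i, IsLipschitzDGF (A i) (h i) (grad i)) :
    ∃ c : ℝ, 0 ≤ c ∧ ∀ x ∈ actionSpace A, ∀ p ∈ actionSpace A, ∀ x' : PiLp 2 E,
      ∀ (v : PiLp 2 (fun i => StrongDual ℝ (E i))) (γ B : ℝ), (∀ i, ‖v i‖ ≤ B) →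
        (∀ i, IsProx (A i) (h i) (grad i) (x i) (γ • v i) (x' i)) →
        energy h grad p x' ≤ energy h grad p x + γ * pairing v (x - p) + c * (γ * B) ^ 2 := by
  choose K hK hsc using fun i => (hh i).1.strong_convex
  simp_rw [fun i => (hh i).proxDomain_eq (hA i)] at hsc
  refine ⟨∑ i, 1 / (2 * K i), Finset.sum_nonneg fun i _ => by have := hK i; positivity,
    fun x hx p hp x' v γ B hB hprox => ?_⟩
  have key : ∀ i, bregman (h i) (grad i) (p i) (x' i) ≤ bregman (h i) (grad i) (p i) (x i) +
      γ * v i (x i - p i) + 1 / (2 * K i) * (γ * B) ^ 2 := by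
    intro i
    have h1 := (hh i).bregman_prox_le (hA i) (hK i) (hsc i) (hx i) (hp i) (hprox i)
    have h2 : ‖γ • v i‖ ^ 2 ≤ (γ * B) ^ 2 := by
      rw [norm_smul, mul_pow, mul_pow, Real.norm_eq_abs, sq_abs]
      have := hB i
      gcongr
    have h3 : ‖γ • v i‖ ^ 2 / (2 * K i) ≤ 1 / (2 * K i) * (γ * B) ^ 2 := by
      have := hK i
      rw [div_eq_mul_one_div, mul_comm]
      gcongr
    simp only [smul_apply, smul_eq_mul] at h1
    linarith
  have hsum := Finset.sum_le_sum fun i (_ : i ∈ Finset.univ) => key i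
  rw [Finset.sum_add_distrib, Finset.sum_add_distrib, ← Finset.mul_sum, ← Finset.sum_mul] at hsum
  exact hsum

lemma exists_mul_norm_sq_le_energy (hA : ∀ i, IsCompact (A i))
    (hh : ∀ i, IsLipschitzDGF (A i) (h i) (grad i)) :
    ∃ κ : ℝ, 0 < κ ∧ ∀ x ∈ actionSpace A, ∀ p ∈ actionSpace A,
      κ * ‖p - x‖ ^ 2 ≤ energy h grad p x := by
  choose K hK hsc using fun i => (hh i).1.strong_convex
  simp_rw [fun i => (hh i).proxDomain_eq (hA i)] at hsc
  have hpos : ∀ i, 0 < 2 / K i := fun i => div_pos two_pos (hK i)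
  have hS : 0 ≤ ∑ i, 2 / K i := Finset.sum_nonneg fun i _ => (hpos i).le
  refine ⟨(1 + ∑ i, 2 / K i)⁻¹, by positivity, fun x hx p hp => ?_⟩
  rw [PiLp.norm_sq_eq_of_L2, Finset.mul_sum]
  refine Finset.sum_le_sum fun i _ => ?_
  have h1 := hsc i _ (hx i) _ (hp i)
  have h2 : (1 + ∑ i, 2 / K i)⁻¹ ≤ K i / 2 := by
    rw [← inv_div]
    refine inv_anti₀ (hpos i) ?_
    have := Finset.single_le_sum (f := fun i => 2 / K i) (fun i _ => (hpos i).le)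
      (Finset.mem_univ i)
    linarith
  have h3 := mul_le_mul_of_nonneg_right h2 (sq_nonneg ‖p i - x i‖)
  simp only [bregman, PiLp.sub_apply]
  linarith

lemma exists_energy_drift_le (hA : ∀ i, IsCompact (A i))
    (hh : ∀ i, IsLipschitzDGF (A i) (h i) (grad i)) :
    ∃ c : ℝ, 0 ≤ c ∧ ∀ x ∈ actionSpace A, ∀ p ∈ actionSpace A, ∀ p' ∈ actionSpace A,
      energy h grad p' x ≤ energy h grad p x + c * ‖p' - p‖ := by
  choose M hM using fun i => (hh i).2
  simp_rw [fun i => (hh i).proxDomain_eq (hA i)] at hM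
  refine ⟨∑ i, 2 * |M i|, by positivity, fun x hx p hp p' hp' => ?_⟩
  unfold energy
  rw [Finset.sum_mul, ← Finset.sum_add_distrib]
  refine Finset.sum_le_sum fun i _ => ?_
  refine ((hh i).bregman_sub_le (hA i) (M := |M i|)
    (fun x hx => (hM i x hx).trans (le_abs_self _)) (hx i) (hp i) (hp' i)).trans ?_
  gcongr
  exact PiLp.norm_apply_le (p' - p) i

end Energy

section Existence

/-- A sequence in a compact convex set has an ergodic limit point. -/
lemma exists_ergodic_limit {F : Type*} [NormedAddCommGroup F] [NormedSpace ℝ F] {S : Set F}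
    (hS : IsCompact S) (hSc : Convex ℝ S) {Y : ℕ → F} (hY : ∀ n, Y n ∈ S) :
    ∃ x ∈ S, ∀ (φ : F →L[ℝ] ℝ) (a C : ℝ),
      (∀ N, ∑ n ∈ Finset.range N, (1 / ((n : ℝ) + 1)) * (a - φ (Y n)) ≤ C) → a ≤ φ x := by
  set γ : ℕ → ℝ := fun n => 1 / ((n : ℝ) + 1) with hγ
  have hγpos : ∀ n, 0 < γ n := fun n => by positivity
  set Γ : ℕ → ℝ := fun N => ∑ n ∈ Finset.range N, γ n with hΓ
  have hΓlim : Tendsto Γ atTop atTop := Real.tendsto_sum_range_one_div_nat_succ_atTop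
  have hΓpos : ∀ N, 0 < Γ (N + 1) := fun N =>
    Finset.sum_pos (fun n _ => hγpos n) ⟨0, by simp⟩
  set Z : ℕ → F := fun N => (Finset.range (N + 1)).centerMass γ Y with hZ
  have hZmem : ∀ N, Z N ∈ S := fun N =>
    hSc.centerMass_mem (fun n _ => (hγpos n).le) (hΓpos N) fun n _ => hY n
  obtain ⟨x, hx, k, hk, hlim⟩ := hS.tendsto_subseq hZmem
  refine ⟨x, hx, fun φ a C hC => ?_⟩
  have hb : ∀ N, a - φ (Z N) ≤ C / Γ (N + 1) := by
    intro N
    rw [le_div_iff₀ (hΓpos N)]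
    refine le_trans (le_of_eq ?_) (hC (N + 1))
    have h1 : φ (Z N) = (Γ (N + 1))⁻¹ * ∑ n ∈ Finset.range (N + 1), γ n * φ (Y n) := by
      simp [hZ, Finset.centerMass, hΓ]
    have h2 : ∑ n ∈ Finset.range (N + 1), γ n * (a - φ (Y n)) = Γ (N + 1) * a -
          ∑ n ∈ Finset.range (N + 1), γ n * φ (Y n) := by
      simp only [mul_sub, Finset.sum_sub_distrib, ← Finset.sum_mul, hΓ]
    rw [h2, h1, sub_mul, mul_comm _ (Γ (N + 1)), mul_comm _ (Γ (N + 1)),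
      mul_inv_cancel_left₀ (hΓpos N).ne']
  have h0 : Tendsto (fun N => C / Γ (N + 1)) atTop (𝓝 0) :=
    ((tendsto_add_atTop_iff_nat 1).2 hΓlim).const_div_atTop _
  have hl : Tendsto (fun N => a - φ (Z (k N))) atTop (𝓝 (a - φ x)) :=
    (((φ.continuous.tendsto x).comp hlim).const_sub a)
  have := le_of_tendsto_of_tendsto' hl (h0.comp hk.tendsto_atTop) fun N => hb (k N)
  linarith

variable {ι : Type*} [Fintype ι] [DecidableEq ι] {E : ι → Type*}
  [∀ i, NormedAddCommGroup (E i)] [∀ i, NormedSpace ℝ (E i)]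
  {A : ∀ i, Set (E i)} {u : ι → PiLp 2 E → ℝ}

lemma IsStrictlyMonotone.pairing_nonpos (hm : IsStrictlyMonotone A u) {x x' : PiLp 2 E}
    (hx : x ∈ actionSpace A) (hx' : x' ∈ actionSpace A) :
    pairing (payoffGradient u x' - payoffGradient u x) (x' - x) ≤ 0 := by
  by_cases h : x' = x
  · subst h; simp [pairing]
  · exact (hm x hx x' hx' h).le

/-- Nash equilibria of a strictly monotone game are unique. -/
lemma IsNash.unique (hu : IsConcaveGame A u) (hA : ∀ i, Convex ℝ (A i))
    (hm : IsStrictlyMonotone A u) {x y : PiLp 2 E} (hx : IsNash A u x) (hy : IsNash A u y) :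
    y = x := by
  by_contra h
  have h1 := hm x hx.1 y hy.1 h
  have h2 := hx.pairing_le hu hA hy.1
  have h3 := hy.pairing_le hu hA hx.1
  rw [pairing_sub_left] at h1
  rw [← neg_sub, pairing_neg_right] at h3
  linarith

/-- A Minty solution of the variational inequality of a concave game is a Nash equilibrium. -/
lemma IsNash.of_minty (hu : IsConcaveGame A u) (hA : ∀ i, Convex ℝ (A i)) {x : PiLp 2 E}
    (hx : x ∈ actionSpace A)
    (h : ∀ y ∈ actionSpace A, pairing (payoffGradient u y) (y - x) ≤ 0) : IsNash A u x := by
  refine IsNash.of_pairing_le hu hx fun z hz => ?_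
  have hm : ∀ t ∈ Set.Ioo (0 : ℝ) 1, x + t • (z - x) ∈ actionSpace A := fun t ht =>
    (convex_actionSpace hA).add_smul_sub_mem hx hz ⟨ht.1.le, ht.2.le⟩
  have hlim : Tendsto (fun t : ℝ => x + t • (z - x)) (𝓝[>] 0) (𝓝[actionSpace A] x) := by
    refine tendsto_nhdsWithin_iff.2 ⟨?_, ?_⟩
    · have : Continuous fun t : ℝ => x + t • (z - x) := by fun_prop
      have h4 := (this.tendsto 0).mono_left (nhdsWithin_le_nhds (s := Set.Ioi 0))
      simpa using h4
    · filter_upwards [Ioo_mem_nhdsGT (zero_lt_one (α := ℝ))] with t ht using hm t ht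
  have hv := (hu.continuousOn_payoffGradient x hx).tendsto.comp hlim
  have hp := (continuous_pairing.tendsto (payoffGradient u x, z - x)).comp
    (hv.prodMk_nhds tendsto_const_nhds)
  refine le_of_tendsto hp ?_
  filter_upwards [Ioo_mem_nhdsGT (zero_lt_one (α := ℝ))] with t ht
  have h1 := h _ (hm t ht)
  rw [add_sub_cancel_left, pairing_smul_right] at h1
  exact nonpos_of_mul_nonpos_right h1 ht.1

/-- Mirror descent with step-sizes `1 / (n + 1)` has bounded weighted regret. -/
lemma exists_bounded_regret [∀ i, FiniteDimensional ℝ (E i)] (hu : IsConcaveGame A u)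
    (hA : ∀ i, IsCompact (A i)) (hm : IsStrictlyMonotone A u)
    {h : ∀ i, E i → ℝ} {grad : ∀ i, E i → StrongDual ℝ (E i)}
    (hh : ∀ i, IsLipschitzDGF (A i) (h i) (grad i)) :
    ∃ Y : ℕ → PiLp 2 E, (∀ n, Y n ∈ actionSpace A) ∧ ∀ p ∈ actionSpace A, ∃ C : ℝ, ∀ N,
      ∑ n ∈ Finset.range N, (1 / ((n : ℝ) + 1)) *
        pairing (payoffGradient u p) (p - Y n) ≤ C := by
  have hX := isCompact_actionSpace hA
  obtain ⟨c, hc, hstep⟩ := exists_energy_prox_le hA hh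
  obtain ⟨κ, hκ, hlow⟩ := exists_mul_norm_sq_le_energy hA hh
  obtain ⟨G, hG⟩ :=
    (hX.image_of_continuousOn hu.continuousOn_payoffGradient).isBounded.exists_norm_le
  have hne : (actionSpace A).Nonempty := by
    choose x hx using fun i => (hh i).1.nonempty
    exact ⟨WithLp.toLp 2 x, hx⟩
  obtain ⟨x₀, hx₀⟩ := hne
  choose next hnext using fun (n : ℕ) (x : PiLp 2 E) (i : ι) => (hh i).1.exists_isProx (hA i) (x i)
    ((1 / ((n : ℝ) + 1)) • payoffGradient u x i)
  obtain ⟨Y, hY0, hYs⟩ : ∃ Y : ℕ → PiLp 2 E, Y 0 = x₀ ∧ ∀ n i, IsProx (A i) (h i) (grad i) (Y n i)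
      ((1 / ((n : ℝ) + 1)) • payoffGradient u (Y n) i) (Y (n + 1) i) :=
    ⟨fun n => Nat.rec x₀ (fun n x => WithLp.toLp 2 (next n x)) n, rfl, fun n i => hnext n _ i⟩
  have hY : ∀ n, Y n ∈ actionSpace A := by
    intro n
    cases n with
    | zero => exact hY0 ▸ hx₀
    | succ n => exact fun i => (hYs n i).1
  have hsummable : Summable fun n : ℕ => (1 / ((n : ℝ) + 1)) ^ 2 := by
    have h1 := (summable_nat_add_iff 1).2 (Real.summable_one_div_nat_pow.2 one_lt_two)
    refine h1.congr fun n => ?_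
    simp
  refine ⟨Y, hY, fun p hp => ⟨energy h grad p x₀ + c * G ^ 2 * ∑' n : ℕ, (1 / ((n : ℝ) + 1)) ^ 2,
    fun N => ?_⟩⟩
  have h1 : ∀ n : ℕ, (1 / ((n : ℝ) + 1)) * pairing (payoffGradient u p) (p - Y n) ≤
      energy h grad p (Y n) - energy h grad p (Y (n + 1)) +
        c * G ^ 2 * (1 / ((n : ℝ) + 1)) ^ 2 := by
    intro n
    have a1 := hstep (Y n) (hY n) p hp (Y (n + 1)) (payoffGradient u (Y n)) (1 / ((n : ℝ) + 1)) G
      (fun i => (PiLp.norm_apply_le _ i).trans (hG _ (Set.mem_image_of_mem _ (hY n)))) (hYs n)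
    have a2 := hm.pairing_nonpos hp (hY n)
    rw [pairing_sub_left] at a2
    have a3 : pairing (payoffGradient u p) (p - Y n) =
        -pairing (payoffGradient u p) (Y n - p) := by
      rw [← pairing_neg_right, neg_sub]
    have a4 := mul_le_mul_of_nonneg_left a2 (by positivity : 0 ≤ 1 / ((n : ℝ) + 1))
    rw [a3]
    linarith
  refine (Finset.sum_le_sum fun n _ => h1 n).trans ?_
  rw [Finset.sum_add_distrib, Finset.sum_range_sub' fun n => energy h grad p (Y n),
    ← Finset.mul_sum, hY0]
  have h2 : 0 ≤ energy h grad p (Y N) := (by positivity : 0 ≤ κ * ‖p - Y N‖ ^ 2).trans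
    (hlow _ (hY N) _ hp)
  have h3 : ∑ n ∈ Finset.range N, (1 / ((n : ℝ) + 1)) ^ 2 ≤ ∑' n : ℕ, (1 / ((n : ℝ) + 1)) ^ 2 :=
    hsummable.sum_le_tsum _ fun n _ => sq_nonneg _
  have h4 := mul_le_mul_of_nonneg_left h3 (by positivity : 0 ≤ c * G ^ 2)
  linarith

/-- A monotone game has a Nash equilibrium, namely any limit point of the ergodic averages of mirror
descent. -/
lemma exists_isNash [∀ i, FiniteDimensional ℝ (E i)] (hu : IsConcaveGame A u)
    (hA : ∀ i, IsCompact (A i)) (hAc : ∀ i, Convex ℝ (A i)) (hm : IsStrictlyMonotone A u)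
    {h : ∀ i, E i → ℝ} {grad : ∀ i, E i → StrongDual ℝ (E i)}
    (hh : ∀ i, IsLipschitzDGF (A i) (h i) (grad i)) : ∃ x, IsNash A u x := by
  obtain ⟨Y, hY, hreg⟩ := exists_bounded_regret hu hA hm hh
  obtain ⟨x, hx, hlim⟩ := exists_ergodic_limit (isCompact_actionSpace hA) (convex_actionSpace hAc) hY
  refine ⟨x, IsNash.of_minty hu hAc hx fun p hp => ?_⟩
  obtain ⟨C, hC⟩ := hreg p hp
  set φ : PiLp 2 E →L[ℝ] ℝ := ∑ i, (payoffGradient u p i).comp (PiLp.proj 2 E i) with hφ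
  have e : ∀ y, pairing (payoffGradient u p) y = φ y := fun y => by
    simp [hφ, pairing]
  have := hlim φ (φ p) C fun N => by
    simpa only [e, map_sub] using hC N
  rw [e, map_sub]
  linarith

end Existence

section Probability

variable {Ω : Type*}

/-- Evaluating a Carathéodory function along a strongly measurable process. -/
lemma stronglyMeasurable_comp_continuousOn {m : MeasurableSpace Ω} {α β : Type*}
    [TopologicalSpace α] [TopologicalSpace.MetrizableSpace α] [SecondCountableTopology α]
    [TopologicalSpace β] [TopologicalSpace.PseudoMetrizableSpace β] {S : Set α} {f : Ω → α → β}
    (hf : ∀ ω, ContinuousOn (f ω) S) (hfm : ∀ x ∈ S, StronglyMeasurable fun ω => f ω x)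
    {g : Ω → α} (hg : StronglyMeasurable g) (hgS : ∀ ω, g ω ∈ S) :
    StronglyMeasurable fun ω => f ω (g ω) := by
  let _ : MeasurableSpace α := borel α
  have : BorelSpace α := ⟨rfl⟩
  have h1 : StronglyMeasurable (Function.uncurry fun (x : S) (ω : Ω) => f ω x) :=
    stronglyMeasurable_uncurry_of_continuous_of_stronglyMeasurable
      (fun ω => continuousOn_iff_continuous_domRestrict.1 (hf ω)) (fun x => hfm x x.2)
  have h2 : Measurable fun ω => ((⟨g ω, hgS ω⟩ : S), ω) :=
    hg.measurable.subtype_mk.prodMk measurable_id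
  exact h1.comp_measurable h2

lemma stronglyMeasurable_comp_fintype {m : MeasurableSpace Ω} {W β : Type*} [Fintype W]
    [MeasurableSpace W] [MeasurableSingletonClass W] [NormedAddCommGroup β] {w : Ω → W}
    (hw : Measurable w) {G : W → Ω → β} (hG : ∀ e, StronglyMeasurable (G e)) :
    StronglyMeasurable fun ω => G (w ω) ω := by
  classical
  have h : (fun ω => G (w ω) ω) = fun ω => ∑ e, (w ⁻¹' {e}).indicator (G e) ω := by
    ext ω
    rw [Finset.sum_eq_single (w ω)]
    · simp
    · intro e _ he
      have : ω ∉ w ⁻¹' {e} := fun h => he (Eq.symm h)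
      rw [Set.indicator_of_notMem this]
    · simp
  rw [h]
  exact Finset.stronglyMeasurable_fun_sum _ fun e _ =>
    (hG e).indicator (hw (measurableSet_singleton e))

lemma integrable_of_abs_le {mΩ : MeasurableSpace Ω} {P : Measure Ω} [IsFiniteMeasure P]
    {f : Ω → ℝ} (hf : StronglyMeasurable f) {C : ℝ} (hC : ∀ ω, |f ω| ≤ C) : Integrable f P :=
  Integrable.of_bound hf.aestronglyMeasurable C (Eventually.of_forall hC)

/-- Sampling uniformly and independently of `m` among finitely many `m`-measurable functions yields
their average in conditional mean. -/
lemma condExp_uniform_sample_sub_average {m mΩ : MeasurableSpace Ω} (hm : m ≤ mΩ) {P : Measure Ω}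
    [IsProbabilityMeasure P] {W : Type*} [Fintype W] [MeasurableSpace W]
    [MeasurableSingletonClass W] {w : Ω → W} (hw : Measurable w)
    (hind : Indep (MeasurableSpace.comap w inferInstance) m P)
    (hunif : ∀ e, P.real {ω | w ω = e} = (Fintype.card W : ℝ)⁻¹) {g : W → Ω → ℝ}
    (hg : ∀ e, StronglyMeasurable[m] (g e)) {C : ℝ} (hC : ∀ e ω, |g e ω| ≤ C) :
    P[fun ω => g (w ω) ω - (Fintype.card W : ℝ)⁻¹ * ∑ e, g e ω | m] =ᵐ[P] 0 := by
  classical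
  set N : ℝ := ((Fintype.card W : ℕ) : ℝ) with hN
  set I : W → Ω → ℝ := fun e ω => (w ⁻¹' {e}).indicator (fun _ => (1 : ℝ)) ω - N⁻¹ with hI
  have hIm : ∀ e, StronglyMeasurable[MeasurableSpace.comap w inferInstance] (I e) := fun e => by
    have h1 : MeasurableSet[MeasurableSpace.comap w inferInstance] (w ⁻¹' {e}) :=
      ⟨{e}, measurableSet_singleton e, rfl⟩
    exact (stronglyMeasurable_const.indicator h1).sub stronglyMeasurable_const
  have hle : MeasurableSpace.comap w inferInstance ≤ mΩ := hw.comap_le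
  have hset : ∀ e, MeasurableSet (w ⁻¹' {e}) := fun e => hw (measurableSet_singleton e)
  have hIint : ∀ e, Integrable (I e) P := fun e =>
    ((integrable_const _).indicator (hset e)).sub (integrable_const _)
  have hmul : ∀ e, Integrable (I e * g e) P := fun e =>
    (hIint e).mul_bdd (c := C) ((hg e).mono hm).aestronglyMeasurable
      (Eventually.of_forall fun ω => hC e ω)
  have heq : (fun ω => g (w ω) ω - N⁻¹ * ∑ e, g e ω) = ∑ e, I e * g e := by
    ext ω
    simp only [Finset.sum_apply, Pi.mul_apply, hI, sub_mul, Finset.sum_sub_distrib, ← Finset.mul_sum]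
    congr 1
    rw [Finset.sum_eq_single (w ω)]
    · simp
    · intro e _ he
      have : ω ∉ w ⁻¹' {e} := fun h => he (Eq.symm h)
      rw [Set.indicator_of_notMem this, zero_mul]
    · simp
  rw [heq]
  refine (condExp_finsetSum (fun e _ => hmul e) m).trans ?_
  have hz : ∀ e, P[I e * g e | m] =ᵐ[P] 0 := by
    intro e
    have h1 := condExp_mul_of_stronglyMeasurable_right (hg e) (hmul e) (hIint e)
    have h2 := condExp_indep_eq hle hm (hIm e) hind
    have h3 : ∫ ω, I e ω ∂P = 0 := by
      simp only [hI]
      rw [integral_sub ((integrable_const _).indicator (hset e)) (integrable_const _),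
        integral_indicator_const _ (hset e), integral_const]
      have := hunif e
      simp only [probReal_univ, smul_eq_mul, mul_one, one_mul]
      rw [show P.real (w ⁻¹' {e}) = N⁻¹ from this, sub_self]
    filter_upwards [h1, h2] with ω a1 a2
    rw [a1, Pi.mul_apply, a2, h3, zero_mul, Pi.zero_apply]
  have hall : ∀ᵐ ω ∂P, ∀ e, P[I e * g e | m] ω = 0 := ae_all_iff.2 hz
  filter_upwards [hall] with ω h
  simp [Finset.sum_apply, h]

lemma integral_eq_zero_of_condExp {m mΩ : MeasurableSpace Ω} (hm : m ≤ mΩ) {P : Measure Ω}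
    [IsProbabilityMeasure P] {f : Ω → ℝ} (hf : P[f | m] =ᵐ[P] 0) : ∫ ω, f ω ∂P = 0 := by
  rw [← integral_condExp hm, integral_congr_ae hf]
  simp

/-- Sums of bounded martingale differences with square-summable bounds converge almost surely. -/
lemma ae_tendsto_sum_martingale_diff {mΩ : MeasurableSpace Ω} {P : Measure Ω}
    [IsProbabilityMeasure P] {ℱ : Filtration ℕ mΩ} {ξ : ℕ → Ω → ℝ}
    (hξ : ∀ n, StronglyMeasurable[ℱ (n + 1)] (ξ n)) {a : ℕ → ℝ} (ha : ∀ n ω, |ξ n ω| ≤ a n)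
    (hcond : ∀ n, P[ξ n | ℱ n] =ᵐ[P] 0) (hsum : Summable fun n => a n ^ 2) :
    ∀ᵐ ω ∂P, ∃ l, Tendsto (fun N => ∑ n ∈ Finset.range N, ξ n ω) atTop (𝓝 l) := by
  set M : ℕ → Ω → ℝ := fun N ω => ∑ n ∈ Finset.range N, ξ n ω with hM
  have hMm : ∀ N, StronglyMeasurable[ℱ N] (M N) := fun N =>
    Finset.stronglyMeasurable_fun_sum _ fun n hn =>
      (hξ n).mono (ℱ.mono (Nat.succ_le_of_lt (Finset.mem_range.1 hn)))
  have hMb : ∀ N ω, |M N ω| ≤ ∑ n ∈ Finset.range N, a n := fun N ω =>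
    (Finset.abs_sum_le_sum_abs _ _).trans (Finset.sum_le_sum fun n _ => ha n ω)
  have hMi : ∀ N, Integrable (M N) P := fun N =>
    integrable_of_abs_le ((hMm N).mono (ℱ.le N)) (hMb N)
  have hξi : ∀ n, Integrable (ξ n) P := fun n =>
    integrable_of_abs_le ((hξ n).mono (ℱ.le _)) (ha n)
  have hmart : Martingale M ℱ P := by
    refine martingale_of_condExp_sub_eq_zero_nat hMm hMi fun n => ?_
    have : M (n + 1) - M n = ξ n := by
      ext ω
      simp [hM, Finset.sum_range_succ]
    rw [this]
    exact hcond n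
  have hMξ : ∀ n, Integrable (M n * ξ n) P := fun n =>
    (hξi n).bdd_mul ((hMm n).mono (ℱ.le n)).aestronglyMeasurable
      (Eventually.of_forall (hMb n))
  have hcross : ∀ n, ∫ ω, (M n * ξ n) ω ∂P = 0 := by
    intro n
    refine integral_eq_zero_of_condExp (ℱ.le n) ?_
    filter_upwards [condExp_mul_of_stronglyMeasurable_left (hMm n) (hMξ n) (hξi n), hcond n]
      with ω h1 h2
    rw [h1, Pi.mul_apply, h2, Pi.zero_apply, mul_zero]
  have hsqi : ∀ N, Integrable (fun ω => M N ω ^ 2) P := fun N =>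
    integrable_of_abs_le (((hMm N).mono (ℱ.le N)).pow 2)
      (C := (∑ n ∈ Finset.range N, a n) ^ 2) fun ω => by
        rw [abs_pow]; exact pow_le_pow_left₀ (abs_nonneg _) (hMb N ω) 2
  have hξsq : ∀ n ω, |ξ n ω ^ 2| ≤ a n ^ 2 := fun n ω => by
    rw [abs_pow]; exact pow_le_pow_left₀ (abs_nonneg _) (ha n ω) 2
  have hξsqi : ∀ n, Integrable (fun ω => ξ n ω ^ 2) P := fun n =>
    integrable_of_abs_le (((hξ n).mono (ℱ.le _)).pow 2) (hξsq n)
  have hsq : ∀ N, ∫ ω, M N ω ^ 2 ∂P ≤ ∑ n ∈ Finset.range N, a n ^ 2 := by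
    intro N
    induction N with
    | zero => simp [hM]
    | succ N ih =>
      have e : (fun ω => M (N + 1) ω ^ 2) =
          fun ω => M N ω ^ 2 + (2 * (M N * ξ N) ω + ξ N ω ^ 2) := by
        ext ω
        simp only [hM, Finset.sum_range_succ, Pi.mul_apply]
        ring
      have hi : Integrable (fun ω => 2 * (M N * ξ N) ω + ξ N ω ^ 2) P :=
        ((hMξ N).const_mul 2).add (hξsqi N)
      rw [e, integral_add (hsqi N) hi, integral_add ((hMξ N).const_mul 2) (hξsqi N), integral_const_mul,
        hcross N, Finset.sum_range_succ]
      have : ∫ ω, ξ N ω ^ 2 ∂P ≤ a N ^ 2 := by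
        calc _ ≤ ∫ _, a N ^ 2 ∂P := integral_mono (hξsqi N) (integrable_const _)
              fun ω => (le_abs_self _).trans (hξsq N ω)
          _ = a N ^ 2 := by simp
      linarith
  have hL1 : ∀ N, eLpNorm (M N) 1 P ≤ ((1 + ∑' n, a n ^ 2).toNNReal : NNReal) := by
    intro N
    have h1 : ∫ ω, |M N ω| ∂P ≤ 1 + ∑' n, a n ^ 2 := by
      calc ∫ ω, |M N ω| ∂P ≤ ∫ ω, (1 + M N ω ^ 2) ∂P :=
            integral_mono (hMi N).abs ((integrable_const _).add (hsqi N)) fun ω => by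
              simp only
              nlinarith [sq_nonneg (|M N ω| - 1), sq_abs (M N ω), abs_nonneg (M N ω)]
        _ = 1 + ∫ ω, M N ω ^ 2 ∂P := by
            rw [integral_add (integrable_const _) (hsqi N)]; simp
        _ ≤ _ := by
            have := (hsq N).trans (hsum.sum_le_tsum _ fun n _ => sq_nonneg _)
            linarith
    rw [eLpNorm_one_eq_lintegral_enorm, ← ofReal_integral_norm_eq_lintegral_enorm (hMi N)]
    exact ENNReal.ofReal_le_ofReal h1
  exact hmart.submartingale.exists_ae_tendsto_of_bdd hL1

end Probability

section Trajectory

lemma stronglyMeasurable_apply {ι Ω : Type*} {E : ι → Type*}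
    [∀ i, NormedAddCommGroup (E i)] {m : MeasurableSpace Ω} {X : Ω → PiLp 2 E}
    (hX : StronglyMeasurable X) (i : ι) : StronglyMeasurable fun ω => X ω i :=
  (PiLp.continuous_apply 2 E i).comp_stronglyMeasurable hX

variable {ι : Type*} {E : ι → Type*}
  [∀ i, NormedAddCommGroup (E i)] [∀ i, NormedSpace ℝ (E i)]
  {d : ι → ℕ} {b : ∀ i, Module.Basis (Fin (d i)) ℝ (E i)} {A : ∀ i, Set (E i)}
  {Ω : Type*} {w : ℕ → Ω → ∀ i, Direction (d i)} {u : ℕ → Ω → ι → PiLp 2 E → ℝ}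
  {h : ∀ i, E i → ℝ} {grad : ∀ i, E i → StrongDual ℝ (E i)}
  {base : ∀ i, E i} {r : ι → ℝ} {γ δ : ℕ → ℝ} {X Xhat : ℕ → Ω → PiLp 2 E}

lemma IsUniformSampling.measurable_profile {mΩ : MeasurableSpace Ω} {P : Measure Ω}
    {ℱ : Filtration ℕ mΩ} (hw : IsUniformSampling P ℱ w) (n : ℕ) :
    Measurable[ℱ (n + 1)] (w n) :=
  @measurable_pi_lambda _ _ _ (ℱ (n + 1)) _ _ fun i => hw.measurable n i

lemma continuous_queryProfile {δ : ℝ} (e : ∀ i, Direction (d i)) :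
    Continuous fun x : PiLp 2 E => queryProfile b base r δ x e := by
  refine (PiLp.continuous_toLp 2 E).comp (continuous_pi fun i => ?_)
  have := PiLp.continuous_apply 2 E i
  unfold query
  fun_prop

variable [∀ i, FiniteDimensional ℝ (E i)]

lemma IsPayoffBasedPlay.mem (hX : IsPayoffBasedPlay A u b h grad base r γ δ w X Xhat) (n : ℕ)
    (ω : Ω) : X n ω ∈ actionSpace A := by
  intro i
  cases n with
  | zero => exact (hX.init ω i).1
  | succ n => exact (hX.update n ω i).1

lemma IsPayoffBasedPlay.Xhat_eq (hX : IsPayoffBasedPlay A u b h grad base r γ δ w X Xhat) (n : ℕ)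
    (ω : Ω) : Xhat n ω = queryProfile b base r (δ n) (X n ω) (w n ω) := by
  ext i
  exact hX.play n ω i

lemma IsPayoffBasedPlay.isProx (hX : IsPayoffBasedPlay A u b h grad base r γ δ w X Xhat) (n : ℕ)
    (ω : Ω) (i : ι) : IsProx (A i) (h i) (grad i) (X n ω i)
      (γ n • estimateProfile b base r (δ n) (u n ω) (X n ω) (w n ω) i) (X (n + 1) ω i) := by
  have := hX.update n ω i
  rwa [hX.Xhat_eq] at this

end Trajectory

section Learning

variable {ι : Type*} [Fintype ι] {E : ι → Type*}
  [∀ i, NormedAddCommGroup (E i)] [∀ i, NormedSpace ℝ (E i)]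
  {d : ι → ℕ} {b : ∀ i, Module.Basis (Fin (d i)) ℝ (E i)} {A : ∀ i, Set (E i)}
  {Ω : Type*} {mΩ : MeasurableSpace Ω} {P : Measure Ω}
  {ℱ : Filtration ℕ mΩ} {w : ℕ → Ω → ∀ i, Direction (d i)}

lemma IsUniformSampling.measureReal_eq [DecidableEq ι] (hw : IsUniformSampling P ℱ w) (n : ℕ)
    (e : ∀ i, Direction (d i)) :
    P.real {ω | w n ω = e} = (Fintype.card (∀ i, Direction (d i)) : ℝ)⁻¹ := by
  have h1 : {ω | w n ω = e} = ⋂ i ∈ (Finset.univ : Finset ι), (fun ω => w n ω i) ⁻¹' {e i} := by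
    ext ω
    simp [funext_iff]
  have h2 := (hw.indep_players n).measure_inter_preimage_eq_mul Finset.univ (sets := fun i => {e i})
    fun i _ => measurableSet_singleton (e i)
  have h3 : ∀ i, P ((fun ω => w n ω i) ⁻¹' {e i}) = ((2 * d i : ℕ) : ENNReal)⁻¹ := fun i =>
    hw.uniform n i (e i)
  rw [Measure.real, h1, h2, ENNReal.toReal_prod]
  simp only [h3, ENNReal.toReal_inv, ENNReal.toReal_natCast, Fintype.card_pi, Fintype.card_prod,
    Fintype.card_fin, Fintype.card_bool, Nat.cast_prod, Finset.prod_inv_distrib]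
  simp only [mul_comm]

lemma stronglyMeasurable_profile {m : MeasurableSpace Ω} {X : Ω → PiLp 2 E}
    (hX : ∀ i, StronglyMeasurable fun ω => X ω i) : StronglyMeasurable X := by
  classical
  have h : X = fun ω => ∑ i, inclusion E i (X ω i) := by
    ext ω j
    simp [inclusion_apply, WithLp.ofLp_sum, Finset.sum_apply, Finset.sum_pi_single]
  rw [h]
  exact Finset.stronglyMeasurable_fun_sum _ fun i _ =>
    (inclusion E i).continuous.comp_stronglyMeasurable (hX i)

lemma stronglyMeasurable_pairing {m : MeasurableSpace Ω}
    {v : Ω → PiLp 2 (fun i => StrongDual ℝ (E i))} {x : Ω → PiLp 2 E}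
    (hv : ∀ i, StronglyMeasurable fun ω => v ω i) (hx : StronglyMeasurable x) :
    StronglyMeasurable fun ω => pairing (v ω) (x ω) :=
  continuous_pairing.comp_stronglyMeasurable ((stronglyMeasurable_profile hv).prodMk hx)

variable [∀ i, FiniteDimensional ℝ (E i)]
  {u : ℕ → Ω → ι → PiLp 2 E → ℝ}
  {h : ∀ i, E i → ℝ} {grad : ∀ i, E i → StrongDual ℝ (E i)}
  {base : ∀ i, E i} {r : ι → ℝ} {γ δ : ℕ → ℝ} {X Xhat : ℕ → Ω → PiLp 2 E}

lemma exists_norm_Xhat_sub_le (hA : ∀ i, IsCompact (A i)) (hs : IsSafe A b base r) :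
    ∃ B : ℝ, 0 ≤ B ∧ ∀ (γ δ : ℕ → ℝ) (X Xhat : ℕ → Ω → PiLp 2 E), (∀ n, 0 < δ n) →
      IsPayoffBasedPlay A u b h grad base r γ δ w X Xhat →
      ∀ n ω, ‖Xhat n ω - X n ω‖ ≤ B * δ n := by
  obtain ⟨B, hB0, hB⟩ := exists_norm_shiftProfile_sub_le (b := b) hA hs
  refine ⟨B, hB0, fun γ δ X Xhat hδ hX n ω => ?_⟩
  rw [hX.Xhat_eq, queryProfile_eq_shiftProfile hs.radius_pos]
  exact hB _ (hX.mem n ω) _ _ (hδ n) _ fun _ => (abs_of_pos (hδ n)).le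

variable [DecidableEq ι]

lemma stronglyMeasurable_estimateProfile (hu : IsTimeVaryingGame ℱ A u)
    (hA : ∀ i, Convex ℝ (A i)) (hs : IsSafe A b base r)
    (hδ : ∀ n, 0 < δ n) (hδr : ∀ n i, δ n ≤ r i)
    (hX : IsPayoffBasedPlay A u b h grad base r γ δ w X Xhat) {n : ℕ}
    (hXm : StronglyMeasurable[ℱ n] (X n)) (e : ∀ i, Direction (d i)) (i : ι) :
    StronglyMeasurable[ℱ n] fun ω => estimateProfile b base r (δ n) (u n ω) (X n ω) e i := by
  have hq : Set.MapsTo (fun x => queryProfile b base r (δ n) x e) (actionSpace A)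
      (actionSpace A) := fun x hx => queryProfile_mem hA hs hx (hδ n) (hδr n) e
  have h1 : StronglyMeasurable[ℱ n] fun ω => u n ω i (queryProfile b base r (δ n) (X n ω) e) :=
    stronglyMeasurable_comp_continuousOn (S := actionSpace A)
      (f := fun ω x => u n ω i (queryProfile b base r (δ n) x e))
      (fun ω => ((hu.concave n ω).continuousOn_payoff i).comp
        (continuous_queryProfile e).continuousOn hq)
      (fun x hx => (hu.measurable n i _ (hq hx)).stronglyMeasurable) hXm (hX.mem n)
  exact (h1.const_mul _).smul_const _

lemma IsPayoffBasedPlay.stronglyMeasurable (hu : IsTimeVaryingGame ℱ A u)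
    (hA : ∀ i, IsCompact (A i)) (hAc : ∀ i, Convex ℝ (A i)) (hs : IsSafe A b base r)
    (hh : ∀ i, IsLipschitzDGF (A i) (h i) (grad i))
    (hδ : ∀ n, 0 < δ n) (hδr : ∀ n i, δ n ≤ r i) (hw : IsUniformSampling P ℱ w)
    (hX : IsPayoffBasedPlay A u b h grad base r γ δ w X Xhat) (n : ℕ) :
    StronglyMeasurable[ℱ n] (X n) := by
  choose Q hQc hQ using fun i => (hh i).exists_mirrorMap (hA i)
  induction n with
  | zero =>
    refine stronglyMeasurable_profile fun i => ?_
    have : (fun ω => X 0 ω i) = fun _ => Q i 0 := by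
      ext ω
      exact hQ i 0 _ (hX.init ω i).1 (by simpa using (hX.init ω i).2)
    rw [this]
    exact stronglyMeasurable_const
  | succ n ih =>
    refine stronglyMeasurable_profile fun i => ?_
    have h1 : (fun ω => X (n + 1) ω i) = fun ω => Q i (grad i (X n ω i) +
        γ n • estimateProfile b base r (δ n) (u n ω) (X n ω) (w n ω) i) := by
      ext ω
      exact hQ i _ _ (hX.mem (n + 1) ω i) (hX.isProx n ω i).isMinOn
    rw [h1]
    have hle : ℱ n ≤ ℱ (n + 1) := ℱ.mono n.le_succ
    have hgrad : StronglyMeasurable[ℱ n] fun ω => grad i (X n ω i) := by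
      have hc := (hh i).1.grad_continuous
      rw [(hh i).proxDomain_eq (hA i)] at hc
      exact stronglyMeasurable_comp_continuousOn (f := fun _ => grad i) (fun _ => hc)
        (fun _ _ => stronglyMeasurable_const) (stronglyMeasurable_apply ih i)
        fun ω => hX.mem n ω i
    have hest : StronglyMeasurable[ℱ (n + 1)] fun ω =>
        estimateProfile b base r (δ n) (u n ω) (X n ω) (w n ω) i :=
      stronglyMeasurable_comp_fintype (hw.measurable_profile n)
        (G := fun e ω => estimateProfile b base r (δ n) (u n ω) (X n ω) e i)
        fun e => (stronglyMeasurable_estimateProfile hu hAc hs hδ hδr hX ih e i).mono hle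
    exact (hQc i).comp_stronglyMeasurable ((hgrad.mono hle).add (hest.const_smul (γ n)))

lemma IsPayoffBasedPlay.stronglyMeasurable_Xhat (hu : IsTimeVaryingGame ℱ A u)
    (hA : ∀ i, IsCompact (A i)) (hAc : ∀ i, Convex ℝ (A i)) (hs : IsSafe A b base r)
    (hh : ∀ i, IsLipschitzDGF (A i) (h i) (grad i))
    (hδ : ∀ n, 0 < δ n) (hδr : ∀ n i, δ n ≤ r i) (hw : IsUniformSampling P ℱ w)
    (hX : IsPayoffBasedPlay A u b h grad base r γ δ w X Xhat) (n : ℕ) :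
    StronglyMeasurable[ℱ (n + 1)] (Xhat n) := by
  have h1 : Xhat n = fun ω => queryProfile b base r (δ n) (X n ω) (w n ω) := by
    ext1 ω
    exact hX.Xhat_eq n ω
  rw [h1]
  exact stronglyMeasurable_comp_fintype (hw.measurable_profile n)
    (G := fun e ω => queryProfile b base r (δ n) (X n ω) e) fun e =>
      (continuous_queryProfile e).comp_stronglyMeasurable
        ((hX.stronglyMeasurable hu hA hAc hs hh hδ hδr hw n).mono (ℱ.mono n.le_succ))

/-- The energy inequality of payoff-based prox-learning, with a martingale noise term, an
`O(δ)` bias and an `O(γ² / δ²)` second-order term. -/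
lemma IsPayoffBasedPlay.exists_energy_le [IsProbabilityMeasure P] (hu : IsTimeVaryingGame ℱ A u)
    (hA : ∀ i, IsCompact (A i)) (hAc : ∀ i, Convex ℝ (A i)) (hs : IsSafe A b base r)
    (hh : ∀ i, IsLipschitzDGF (A i) (h i) (grad i))
    (hγ : ∀ n, 0 ≤ γ n) (hδ : ∀ n, 0 < δ n) (hδr : ∀ n i, δ n ≤ r i)
    (hw : IsUniformSampling P ℱ w)
    (hX : IsPayoffBasedPlay A u b h grad base r γ δ w X Xhat) :
    ∃ C : ℝ, 0 ≤ C ∧ ∀ p : ℕ → Ω → PiLp 2 E, (∀ n, StronglyMeasurable[ℱ n] (p n)) →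
      (∀ n ω, p n ω ∈ actionSpace A) → ∃ ξ : ℕ → Ω → ℝ,
        (∀ n, StronglyMeasurable[ℱ (n + 1)] (ξ n)) ∧ (∀ n ω, |ξ n ω| ≤ C / δ n) ∧
        (∀ n, P[ξ n | ℱ n] =ᵐ[P] 0) ∧
        ∀ n ω, energy h grad (p n ω) (X (n + 1) ω) ≤ energy h grad (p n ω) (X n ω) +
          γ n * pairing (payoffGradient (u n ω) (X n ω)) (X n ω - p n ω) + γ n * (C * δ n) +
          γ n * ξ n ω + C * (γ n / δ n) ^ 2 := by
  have hΩ : Nonempty Ω := P.nonempty_of_neZero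
  have hW : Nonempty (∀ i, Direction (d i)) := ⟨w 0 hΩ.some⟩
  obtain ⟨M, hM⟩ := hu.payoff_bounded
  obtain ⟨L, hL⟩ := hu.gradient_lipschitz
  obtain ⟨B, hB0, hB⟩ := exists_estimateProfile_bias_le (b := b) hA hAc hs |L| (abs_nonneg L)
  obtain ⟨B', hB'0, hB'⟩ := exists_norm_estimateProfile_le (b := b) hAc hs |M| (abs_nonneg M)
  obtain ⟨c, hc0, hc⟩ := exists_energy_prox_le hA hh
  obtain ⟨R, hR⟩ := (isCompact_actionSpace hA).isBounded.exists_norm_le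
  have hR0 : 0 ≤ R := (norm_nonneg _).trans (hR _ (hX.mem 0 hΩ.some))
  set N : ℝ := ((Fintype.card (∀ i, Direction (d i)) : ℕ) : ℝ) with hN
  have hNpos : 0 < N := by rw [hN]; exact_mod_cast Fintype.card_pos
  set k : ℝ := ((Fintype.card ι : ℕ) : ℝ) with hk
  have hk0 : 0 ≤ k := by rw [hk]; positivity
  set C₁ := k * B * (2 * R) with hC₁
  set C₂ := 2 * (k * B' * (2 * R)) with hC₂
  set C₃ := c * B' ^ 2 with hC₃
  have hC₁0 : 0 ≤ C₁ := by positivity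
  have hC₂0 : 0 ≤ C₂ := by positivity
  have hC₃0 : 0 ≤ C₃ := by positivity
  refine ⟨C₁ + C₂ + C₃, by positivity, fun p hpm hp => ?_⟩
  have hdiam : ∀ n ω, ‖X n ω - p n ω‖ ≤ 2 * R := fun n ω =>
    (norm_sub_le _ _).trans (by linarith [hR _ (hX.mem n ω), hR _ (hp n ω)])
  have hest : ∀ n ω e i, ‖estimateProfile b base r (δ n) (u n ω) (X n ω) e i‖ ≤ B' / δ n :=
    fun n ω e i => hB' (u n ω) (fun i x hx => (hM n ω i x hx).trans (le_abs_self M)) (δ n) (hδ n)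
      (hδr n) _ (hX.mem n ω) e i
  set g : ℕ → (∀ i, Direction (d i)) → Ω → ℝ := fun n e ω =>
    pairing (estimateProfile b base r (δ n) (u n ω) (X n ω) e) (X n ω - p n ω) with hg
  have hgm : ∀ n e, StronglyMeasurable[ℱ n] (g n e) := fun n e =>
    stronglyMeasurable_pairing
      (fun i => stronglyMeasurable_estimateProfile hu hAc hs hδ hδr hX
        (hX.stronglyMeasurable hu hA hAc hs hh hδ hδr hw n) e i)
      ((hX.stronglyMeasurable hu hA hAc hs hh hδ hδr hw n).sub (hpm n))
  have hgb : ∀ n e ω, |g n e ω| ≤ k * B' * (2 * R) / δ n := by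
    intro n e ω
    have hδn := hδ n
    refine (abs_pairing_le _ _).trans ?_
    have h1 : ∑ i, ‖estimateProfile b base r (δ n) (u n ω) (X n ω) e i‖ ≤ k * (B' / δ n) := by
      refine (Finset.sum_le_sum fun i _ => hest n ω e i).trans (le_of_eq ?_)
      simp [hk]
    calc _ ≤ k * (B' / δ n) * (2 * R) := by
          gcongr
          exact hdiam n ω
      _ = _ := by ring
  have havg : ∀ n ω, |N⁻¹ * ∑ e, g n e ω| ≤ k * B' * (2 * R) / δ n := by
    intro n ω
    rw [abs_mul, abs_of_pos (inv_pos.2 hNpos), inv_mul_le_iff₀ hNpos]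
    refine (Finset.abs_sum_le_sum_abs _ _).trans
      ((Finset.sum_le_sum fun e _ => hgb n e ω).trans (le_of_eq ?_))
    rw [Finset.sum_const, Finset.card_univ, nsmul_eq_mul]
  refine ⟨fun n ω => g n (w n ω) ω - N⁻¹ * ∑ e, g n e ω, fun n => ?_, fun n ω => ?_, fun n => ?_,
    fun n ω => ?_⟩
  · have hle : ℱ n ≤ ℱ (n + 1) := ℱ.mono n.le_succ
    exact (stronglyMeasurable_comp_fintype (hw.measurable_profile n) fun e =>
      (hgm n e).mono hle).sub ((Finset.stronglyMeasurable_fun_sum _ fun e _ =>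
        (hgm n e).mono hle).const_mul _)
  · have h1 := (abs_sub (g n (w n ω) ω) (N⁻¹ * ∑ e, g n e ω)).trans
      (add_le_add (hgb n (w n ω) ω) (havg n ω))
    have h2 : k * B' * (2 * R) / δ n + k * B' * (2 * R) / δ n = C₂ / δ n := by rw [hC₂]; ring
    rw [h2] at h1
    refine h1.trans (div_le_div_of_nonneg_right ?_ (hδ n).le)
    linarith
  · exact condExp_uniform_sample_sub_average (ℱ.le n)
      ((hw.measurable_profile n).mono (ℱ.le _) le_rfl) (hw.indep_past n)
      (fun e => hw.measureReal_eq n e) (hgm n) (hgb n)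
  · have h1 := hc _ (hX.mem n ω) _ (hp n ω) _
      (estimateProfile b base r (δ n) (u n ω) (X n ω) (w n ω)) (γ n) (B' / δ n)
      (hest n ω (w n ω)) (hX.isProx n ω)
    have h2 : N⁻¹ * ∑ e, g n e ω - pairing (payoffGradient (u n ω) (X n ω)) (X n ω - p n ω) ≤
        C₁ * δ n := by
      have e1 : N⁻¹ * ∑ e, g n e ω -
          pairing (payoffGradient (u n ω) (X n ω)) (X n ω - p n ω) =
          ∑ i, (N⁻¹ • ∑ e, estimateProfile b base r (δ n) (u n ω) (X n ω) e i -
            payoffGradient (u n ω) (X n ω) i) (X n ω i - p n ω i) := by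
        simp only [hg, pairing, sub_apply, smul_apply, smul_eq_mul, sum_apply,
          Finset.sum_sub_distrib, PiLp.sub_apply, ← Finset.mul_sum]
        rw [Finset.sum_comm]
      rw [e1]
      have hδn := hδ n
      have e2 : ∀ i, (N⁻¹ • ∑ e, estimateProfile b base r (δ n) (u n ω) (X n ω) e i -
            payoffGradient (u n ω) (X n ω) i) (X n ω i - p n ω i) ≤ B * δ n * (2 * R) := by
        intro i
        refine (Real.le_norm_self _).trans ((ContinuousLinearMap.le_opNorm _ _).trans ?_)
        have a1 := hB (u n ω) (hu.concave n ω) (fun x hx x' hx' => (hL n ω x hx x' hx').trans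
          (mul_le_mul_of_nonneg_right (le_abs_self L) (norm_nonneg _))) (δ n) (hδ n) (hδr n) _
          (hX.mem n ω) i
        have a2 : ‖X n ω i - p n ω i‖ ≤ 2 * R :=
          (PiLp.norm_apply_le (X n ω - p n ω) i).trans (hdiam n ω)
        exact mul_le_mul a1 a2 (norm_nonneg _) (by positivity)
      refine (Finset.sum_le_sum fun i _ => e2 i).trans (le_of_eq ?_)
      rw [Finset.sum_const, Finset.card_univ, nsmul_eq_mul, hC₁, hk]
      ring
    have h3 : c * (γ n * (B' / δ n)) ^ 2 = C₃ * (γ n / δ n) ^ 2 := by rw [hC₃]; ring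
    rw [h3] at h1
    have h4 : γ n * pairing (estimateProfile b base r (δ n) (u n ω) (X n ω) (w n ω))
        (X n ω - p n ω) = γ n * (g n (w n ω) ω - N⁻¹ * ∑ e, g n e ω) +
        γ n * (N⁻¹ * ∑ e, g n e ω - pairing (payoffGradient (u n ω) (X n ω)) (X n ω - p n ω)) +
        γ n * pairing (payoffGradient (u n ω) (X n ω)) (X n ω - p n ω) := by
      simp only [hg]; ring
    have h5 := mul_le_mul_of_nonneg_left h2 (hγ n)
    have h6 : γ n * (C₁ * δ n) ≤ γ n * ((C₁ + C₂ + C₃) * δ n) := by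
      have := hγ n
      have := (hδ n).le
      gcongr
      linarith
    have h7 : C₃ * (γ n / δ n) ^ 2 ≤ (C₁ + C₂ + C₃) * (γ n / δ n) ^ 2 := by
      gcongr
      linarith
    linarith

end Learning

section Sequences

lemma summable_succ_rpow_iff {a : ℝ} : Summable (fun n : ℕ => ((n : ℝ) + 1) ^ a) ↔ a < -1 := by
  rw [← Real.summable_nat_rpow, ← summable_nat_add_iff (f := fun n : ℕ => (n : ℝ) ^ a) 1]
  simp

lemma sum_succ_rpow_le {s : ℝ} (hs : -1 < s) (hs0 : s ≤ 0) (T : ℕ) :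
    ∑ n ∈ Finset.range T, ((n : ℝ) + 1) ^ s ≤ (T : ℝ) ^ (1 + s) / (1 + s) := by
  have hpos : 0 < 1 + s := by linarith
  induction T with
  | zero => simp [Real.zero_rpow hpos.ne']
  | succ T ih =>
    rw [Finset.sum_range_succ]
    refine (add_le_add_left ih _).trans ?_
    rw [le_div_iff₀ hpos, add_mul, div_mul_cancel₀ _ hpos.ne']
    push_cast
    have hT : (0 : ℝ) < (T : ℝ) + 1 := by positivity
    have h1 : (1 + -(1 / ((T : ℝ) + 1))) ^ (1 + s) ≤ 1 + (1 + s) * -(1 / ((T : ℝ) + 1)) := by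
      refine rpow_one_add_le_one_add_mul_self ?_ hpos.le (by linarith)
      rw [neg_le_neg_iff, div_le_one hT]
      linarith [(Nat.cast_nonneg T : (0 : ℝ) ≤ T)]
    have h2 : (T : ℝ) = ((T : ℝ) + 1) * (1 + -(1 / ((T : ℝ) + 1))) := by field_simp; ring
    have h3 : (0 : ℝ) ≤ 1 + -(1 / ((T : ℝ) + 1)) := by
      have : 1 / ((T : ℝ) + 1) ≤ 1 := by
        rw [div_le_one hT]; linarith [(Nat.cast_nonneg T : (0 : ℝ) ≤ T)]
      linarith
    have h4 : (T : ℝ) ^ (1 + s) ≤ ((T : ℝ) + 1) ^ (1 + s) *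
        (1 + (1 + s) * -(1 / ((T : ℝ) + 1))) := by
      conv_lhs => rw [h2, Real.mul_rpow hT.le h3]
      gcongr
    have h5 : ((T : ℝ) + 1) ^ (1 + s) = ((T : ℝ) + 1) ^ s * ((T : ℝ) + 1) := by
      rw [add_comm 1 s, Real.rpow_add hT, Real.rpow_one]
    have h6 : ((T : ℝ) + 1) ^ (1 + s) * ((1 + s) * -(1 / ((T : ℝ) + 1))) =
        -(((T : ℝ) + 1) ^ s * (1 + s)) := by
      rw [h5]; field_simp
    rw [mul_add, mul_one, h6] at h4
    linarith

/-- Weighted telescoping of a bounded sequence with increasing weights. -/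
lemma sum_mul_sub_le {a D : ℕ → ℝ} (ha : Monotone a) (ha0 : 0 ≤ a 0) {B : ℝ} (hD : ∀ n, D n ≤ B)
    (N : ℕ) : ∑ n ∈ Finset.range (N + 1), a n * (D n - D (n + 1)) ≤ a N * (B - D (N + 1)) := by
  induction N with
  | zero =>
    rw [zero_add, Finset.sum_range_one]
    have := hD 0
    gcongr
  | succ N ih =>
    rw [Finset.sum_range_succ]
    have h1 : a N * (B - D (N + 1)) ≤ a (N + 1) * (B - D (N + 1)) :=
      mul_le_mul_of_nonneg_right (ha N.le_succ) (sub_nonneg.2 (hD _))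
    linarith

lemma sum_le_of_energy_le {γ D s e Δ : ℕ → ℝ} {μ B : ℝ} (hγ : ∀ n, 0 < γ n)
    (hanti : Antitone γ) (hD0 : ∀ n, 0 ≤ D n) (hDB : ∀ n, D n ≤ B) (hΔ : ∀ n, 0 ≤ Δ n)
    (h : ∀ n, γ n * (μ * s n) ≤ D n - D (n + 1) + γ n * e n + Δ n) (N : ℕ) :
    μ * ∑ n ∈ Finset.range (N + 1), s n ≤
      (γ N)⁻¹ * (B + ∑ n ∈ Finset.range (N + 1), Δ n) + ∑ n ∈ Finset.range (N + 1), e n := by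
  have hmono : Monotone fun n => (γ n)⁻¹ := fun m n hmn => inv_anti₀ (hγ n) (hanti hmn)
  have h1 : ∀ n ∈ Finset.range (N + 1), μ * s n ≤
      (γ n)⁻¹ * (D n - D (n + 1)) + (γ N)⁻¹ * Δ n + e n := by
    intro n hn
    have a1 := mul_le_mul_of_nonneg_left (h n) (inv_pos.2 (hγ n)).le
    rw [inv_mul_cancel_left₀ (hγ n).ne', mul_add, mul_add, inv_mul_cancel_left₀ (hγ n).ne'] at a1
    have a2 := mul_le_mul_of_nonneg_right
      (hmono (Nat.lt_succ_iff.1 (Finset.mem_range.1 hn))) (hΔ n)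
    simp only at a2
    linarith
  rw [Finset.mul_sum]
  refine (Finset.sum_le_sum h1).trans ?_
  rw [Finset.sum_add_distrib, Finset.sum_add_distrib, ← Finset.mul_sum, mul_add]
  have h2 := sum_mul_sub_le hmono (inv_pos.2 (hγ 0)).le hDB N
  have h3 : (γ N)⁻¹ * (B - D (N + 1)) ≤ (γ N)⁻¹ * B :=
    mul_le_mul_of_nonneg_left (by linarith [hD0 (N + 1)]) (inv_pos.2 (hγ N)).le
  linarith

/-- A deterministic Robbins-Siegmund lemma: the perturbations need only be conditionally
summable. -/
lemma tendsto_and_frequently_lt_of_descent {F η γ θ : ℕ → ℝ} (hF : ∀ n, 0 ≤ F n)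
    (hη : ∀ n, 0 ≤ η n) (hγ : ∀ n, 0 ≤ γ n) (hγs : ¬ Summable γ) {l : ℝ}
    (hθ : Tendsto (fun N => ∑ n ∈ Finset.range N, θ n) atTop (𝓝 l))
    (h : ∀ n, F (n + 1) ≤ F n - γ n * η n + θ n) :
    (∃ l', Tendsto F atTop (𝓝 l')) ∧ ∀ ε > 0, ∃ᶠ n in atTop, η n < ε := by
  set S : ℕ → ℝ := fun N => ∑ n ∈ Finset.range N, θ n with hS
  obtain ⟨B, hB⟩ := hθ.bddAbove_range
  have hB' : ∀ N, S N ≤ B := fun N => hB (Set.mem_range_self N)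
  have hSs : ∀ n, S (n + 1) = S n + θ n := fun n => Finset.sum_range_succ _ _
  constructor
  · have hanti : Antitone fun n => F n - S n := by
      refine antitone_nat_of_succ_le fun n => ?_
      have := mul_nonneg (hγ n) (hη n)
      rw [hSs]
      linarith [h n]
    have hbdd : BddBelow (Set.range fun n => F n - S n) := by
      refine ⟨-B, ?_⟩
      rintro _ ⟨n, rfl⟩
      simp only
      linarith [hF n, hB' n]
    refine ⟨_, ((tendsto_atTop_ciInf hanti hbdd).add hθ).congr fun n => ?_⟩
    simp
  · intro ε hε hev
    have hsum : Summable fun n => γ n * η n := by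
      refine summable_of_sum_range_le (c := F 0 + B) (fun n => mul_nonneg (hγ n) (hη n)) fun N => ?_
      have : ∑ n ∈ Finset.range N, γ n * η n ≤ F 0 - F N + S N := by
        induction N with
        | zero => simp [hS]
        | succ N ih =>
          rw [Finset.sum_range_succ, hSs]
          linarith [h N]
      linarith [hF N, hB' N]
    refine hγs (Summable.of_norm_bounded_eventually_nat (g := fun n => ε⁻¹ * (γ n * η n))
      (hsum.mul_left _) ?_)
    filter_upwards [hev] with n hn
    rw [Real.norm_of_nonneg (hγ n), inv_mul_eq_div, le_div_iff₀ hε]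
    exact mul_le_mul_of_nonneg_left (not_lt.1 hn) (hγ n)

/-- If a continuous nonnegative function with a unique zero takes arbitrarily small values along a
sequence in a compact set, a subsequence converges to this zero. -/
lemma exists_subseq_tendsto_of_frequently_lt {F : Type*} [PseudoMetricSpace F] {S : Set F}
    (hS : IsCompact S) {f : F → ℝ} (hf : ContinuousOn f S) (hf0 : ∀ y ∈ S, 0 ≤ f y) {z : F}
    (hfz : ∀ y ∈ S, f y = 0 → y = z) {x : ℕ → F} (hx : ∀ n, x n ∈ S)
    (hfreq : ∀ ε > 0, ∃ᶠ n in atTop, f (x n) < ε) :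
    ∃ φ : ℕ → ℕ, StrictMono φ ∧ Tendsto (fun k => x (φ k)) atTop (𝓝 z) := by
  obtain ⟨φ, hφ, hφlt⟩ := extraction_forall_of_frequently
    (P := fun (k n : ℕ) => f (x n) < 1 / ((k : ℝ) + 1)) fun k => hfreq _ (by positivity)
  obtain ⟨y, hy, ψ, hψ, hlim⟩ := hS.tendsto_subseq fun k => hx (φ k)
  have hw : Tendsto (fun k => x (φ (ψ k))) atTop (𝓝[S] y) :=
    tendsto_nhdsWithin_iff.2 ⟨hlim, Eventually.of_forall fun k => hx _⟩
  have hp0 : Tendsto (fun k => f (x (φ (ψ k)))) atTop (𝓝 0) :=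
    squeeze_zero (fun k => hf0 _ (hx _)) (fun k => (hφlt (ψ k)).le)
      (tendsto_one_div_add_atTop_nhds_zero_nat.comp hψ.tendsto_atTop)
  have hyz : y = z := hfz y hy (tendsto_nhds_unique ((hf y hy).tendsto.comp hw) hp0)
  exact ⟨φ ∘ ψ, hφ.comp hψ, hyz ▸ hlim⟩

end Sequences

section Convergence

variable {ι : Type*} [Fintype ι] [DecidableEq ι] {E : ι → Type*}
  [∀ i, NormedAddCommGroup (E i)] [∀ i, NormedSpace ℝ (E i)]
  {A : ∀ i, Set (E i)} {u : ι → PiLp 2 E → ℝ}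

lemma IsConcaveGame.exists_norm_payoffGradient_le (hu : IsConcaveGame A u)
    (hA : ∀ i, IsCompact (A i)) : ∃ G : ℝ, ∀ x ∈ actionSpace A, ‖payoffGradient u x‖ ≤ G := by
  obtain ⟨G, hG⟩ := ((isCompact_actionSpace hA).image_of_continuousOn
    hu.continuousOn_payoffGradient).isBounded.exists_norm_le
  exact ⟨G, fun x hx => hG _ (Set.mem_image_of_mem _ hx)⟩

lemma sum_norm_payoffGradient_sub_le_gameDistance {u' : ι → PiLp 2 E → ℝ}
    (hu : IsConcaveGame A u) (hu' : IsConcaveGame A u') (hA : ∀ i, IsCompact (A i)) {x : PiLp 2 E}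
    (hx : x ∈ actionSpace A) :
    ∑ i, ‖payoffGradient u x i - payoffGradient u' x i‖ ≤ gameDistance A u u' := by
  obtain ⟨G, hG⟩ := hu.exists_norm_payoffGradient_le hA
  obtain ⟨G', hG'⟩ := hu'.exists_norm_payoffGradient_le hA
  refine Finset.sum_le_sum fun i _ => ?_
  refine le_ciSup (f := fun x : actionSpace A =>
    ‖payoffGradient u x i - payoffGradient u' x i‖) ⟨G + G', ?_⟩ ⟨x, hx⟩
  rintro _ ⟨y, rfl⟩
  refine (norm_sub_le _ _).trans (add_le_add ?_ ?_)
  · exact (PiLp.norm_apply_le _ i).trans (hG y y.2)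
  · exact (PiLp.norm_apply_le _ i).trans (hG' y y.2)

lemma IsStrictlyMonotone.pairing_nash_nonpos (hm : IsStrictlyMonotone A u)
    (hu : IsConcaveGame A u) (hA : ∀ i, Convex ℝ (A i)) {x z : PiLp 2 E} (hz : IsNash A u z)
    (hx : x ∈ actionSpace A) : pairing (payoffGradient u x) (x - z) ≤ 0 := by
  have h1 := hm.pairing_nonpos hz.1 hx
  have h2 := hz.pairing_le hu hA hx
  rw [pairing_sub_left] at h1
  linarith

lemma IsStrictlyMonotone.eq_of_pairing_eq_zero (hm : IsStrictlyMonotone A u)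
    (hu : IsConcaveGame A u) (hA : ∀ i, Convex ℝ (A i)) {x z : PiLp 2 E} (hz : IsNash A u z)
    (hx : x ∈ actionSpace A) (h : pairing (payoffGradient u x) (x - z) = 0) : x = z := by
  by_contra hne
  have h1 := hm z hz.1 x hx hne
  have h2 := hz.pairing_le hu hA hx
  rw [pairing_sub_left] at h1
  linarith

/-- Trajectories that obey a perturbed energy inequality converge to the equilibrium. -/
lemma tendsto_nash_of_energy_le [∀ i, FiniteDimensional ℝ (E i)] (hu : IsConcaveGame A u)
    (hm : IsStrictlyMonotone A u) (hA : ∀ i, IsCompact (A i)) (hAc : ∀ i, Convex ℝ (A i))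
    {h : ∀ i, E i → ℝ} {grad : ∀ i, E i → StrongDual ℝ (E i)}
    (hh : ∀ i, IsLipschitzDGF (A i) (h i) (grad i)) {z : PiLp 2 E} (hz : IsNash A u z)
    {x : ℕ → PiLp 2 E} (hx : ∀ n, x n ∈ actionSpace A) {γ θ : ℕ → ℝ} (hγ : ∀ n, 0 ≤ γ n)
    (hγs : ¬ Summable γ) {l : ℝ}
    (hθ : Tendsto (fun N => ∑ n ∈ Finset.range N, θ n) atTop (𝓝 l))
    (hE : ∀ n, energy h grad z (x (n + 1)) ≤ energy h grad z (x n) +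
      γ n * pairing (payoffGradient u (x n)) (x n - z) + θ n) :
    Tendsto x atTop (𝓝 z) := by
  obtain ⟨κ, hκ, hlow⟩ := exists_mul_norm_sq_le_energy hA hh
  obtain ⟨c, hc0, hdrift⟩ := exists_energy_drift_le hA hh
  have hE0 : ∀ n, 0 ≤ energy h grad z (x n) := fun n =>
    (by positivity : 0 ≤ κ * ‖z - x n‖ ^ 2).trans (hlow _ (hx n) _ hz.1)
  obtain ⟨⟨l', hl'⟩, hfreq⟩ := tendsto_and_frequently_lt_of_descent hE0
    (η := fun n => -pairing (payoffGradient u (x n)) (x n - z))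
    (fun n => neg_nonneg.2 (hm.pairing_nash_nonpos hu hAc hz (hx n))) hγ hγs hθ
    (fun n => by linarith [hE n])
  have hcont : ContinuousOn (fun y => -pairing (payoffGradient u y) (y - z)) (actionSpace A) :=
    (continuous_pairing.comp_continuousOn (hu.continuousOn_payoffGradient.prodMk
      (continuousOn_id.sub continuousOn_const))).neg
  obtain ⟨φ, hφ, hlim⟩ := exists_subseq_tendsto_of_frequently_lt (isCompact_actionSpace hA) hcont
    (fun y hy => neg_nonneg.2 (hm.pairing_nash_nonpos hu hAc hz hy))
    (fun y hy h0 => hm.eq_of_pairing_eq_zero hu hAc hz hy (neg_eq_zero.1 h0)) hx hfreq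
  have hnorm0 : Tendsto (fun k => c * ‖z - x (φ k)‖) atTop (𝓝 0) := by
    have h1 : Tendsto (fun k => c * ‖z - x (φ k)‖) atTop (𝓝 (c * ‖z - z‖)) :=
      ((hlim.const_sub z).norm).const_mul c
    simpa using h1
  have hE1 : Tendsto (fun k => energy h grad z (x (φ k))) atTop (𝓝 0) := by
    refine squeeze_zero (fun k => hE0 _) (fun k => ?_) hnorm0
    have := hdrift _ (hx (φ k)) _ (hx (φ k)) _ hz.1
    rwa [energy_self, zero_add] at this
  have hl0 : l' = 0 :=
    tendsto_nhds_unique (hl'.comp hφ.tendsto_atTop) hE1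
  rw [hl0] at hl'
  have hsq : Tendsto (fun n => ‖z - x n‖ ^ 2) atTop (𝓝 0) := by
    refine squeeze_zero (fun n => sq_nonneg _) (fun n => ?_) (by simpa using hl'.const_mul κ⁻¹)
    rw [inv_mul_eq_div, le_div_iff₀ hκ, mul_comm]
    exact hlow _ (hx n) _ hz.1
  have hn : Tendsto (fun n => ‖x n - z‖) atTop (𝓝 0) := by
    have := hsq.sqrt
    simpa [norm_sub_rev] using this
  exact tendsto_iff_norm_sub_tendsto_zero.2 hn

end Convergence

section StepSizes

variable {γ₀ δ₀ p q : ℝ}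

lemma step_mul_radius (n : ℕ) : γ₀ * ((n : ℝ) + 1) ^ (-p) * (δ₀ * ((n : ℝ) + 1) ^ (-q)) =
    γ₀ * δ₀ * ((n : ℝ) + 1) ^ (-(p + q)) := by
  have hn : (0 : ℝ) < (n : ℝ) + 1 := by positivity
  rw [neg_add, Real.rpow_add hn]; ring

lemma step_div_radius (n : ℕ) : γ₀ * ((n : ℝ) + 1) ^ (-p) / (δ₀ * ((n : ℝ) + 1) ^ (-q)) =
    γ₀ / δ₀ * ((n : ℝ) + 1) ^ (q - p) := by
  have hn : (0 : ℝ) < (n : ℝ) + 1 := by positivity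
  rw [show q - p = -p - -q by ring, Real.rpow_sub hn]; ring

lemma sq_step_div_radius (n : ℕ) :
    (γ₀ * ((n : ℝ) + 1) ^ (-p) / (δ₀ * ((n : ℝ) + 1) ^ (-q))) ^ 2 =
      (γ₀ / δ₀) ^ 2 * ((n : ℝ) + 1) ^ (2 * (q - p)) := by
  have hn : (0 : ℝ) ≤ (n : ℝ) + 1 := by positivity
  rw [step_div_radius, mul_pow, mul_comm 2, Real.rpow_mul hn, Real.rpow_two]

lemma antitone_succ_rpow_neg (hp : 0 ≤ p) : Antitone fun n : ℕ => ((n : ℝ) + 1) ^ (-p) :=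
  fun m n hmn => Real.rpow_le_rpow_of_nonpos (by positivity) (by gcongr) (by linarith)

lemma radius_le (hδ₀ : 0 < δ₀) (hq : 0 ≤ q) (n : ℕ) : δ₀ * ((n : ℝ) + 1) ^ (-q) ≤ δ₀ := by
  have h := antitone_succ_rpow_neg hq (Nat.zero_le n)
  simp only [Nat.cast_zero, zero_add, Real.one_rpow] at h
  exact mul_le_of_le_one_right hδ₀.le h

lemma tendsto_succ_rpow_neg (hq : 0 < q) :
    Tendsto (fun n : ℕ => ((n : ℝ) + 1) ^ (-q)) atTop (𝓝 0) := by
  have h := (tendsto_rpow_neg_atTop hq).comp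
    (tendsto_atTop_add_const_right atTop (1 : ℝ) tendsto_natCast_atTop_atTop)
  exact h

end StepSizes

section Main

variable {ι : Type*} [Fintype ι] [DecidableEq ι]
  {E : ι → Type*} [∀ i, NormedAddCommGroup (E i)] [∀ i, NormedSpace ℝ (E i)]
  [∀ i, FiniteDimensional ℝ (E i)]
  {d : ι → ℕ} {b : ∀ i, Module.Basis (Fin (d i)) ℝ (E i)} {A : ∀ i, Set (E i)}
  {Ω : Type*} {mΩ : MeasurableSpace Ω} {P : Measure Ω} [IsProbabilityMeasure P]
  {ℱ : Filtration ℕ mΩ} {u : ℕ → Ω → ι → PiLp 2 E → ℝ}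
  {h : ∀ i, E i → ℝ} {grad : ∀ i, E i → StrongDual ℝ (E i)}
  {base : ∀ i, E i} {r : ι → ℝ} {p q γ₀ δ₀ : ℝ}
  {w : ℕ → Ω → ∀ i, Direction (d i)} {X Xhat : ℕ → Ω → PiLp 2 E}

/-- Convergence of payoff-based play to the equilibrium of the limit game. -/
theorem ae_tendsto_nash_of_stabilizing (hA : ∀ i, IsCompact (A i)) (hAc : ∀ i, Convex ℝ (A i))
    (hu : IsTimeVaryingGame ℱ A u) (hh : ∀ i, IsLipschitzDGF (A i) (h i) (grad i))
    (hs : IsSafe A b base r) (hp1 : p ≤ 1) (hq : 0 < q) (hγ₀ : 0 < γ₀) (hδ₀ : 0 < δ₀)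
    (hδr : ∀ i, δ₀ < r i) (hw : IsUniformSampling P ℱ w)
    (hX : IsPayoffBasedPlay A u b h grad base r
      (fun n => γ₀ * ((n : ℝ) + 1) ^ (-p)) (fun n => δ₀ * ((n : ℝ) + 1) ^ (-q)) w X Xhat)
    {u' : ι → PiLp 2 E → ℝ} {β : ℝ} (hu' : IsConcaveGame A u') (hm : IsStrictlyMonotone A u')
    (hdist : ∀ᵐ ω ∂P, (fun n : ℕ => gameDistance A (u n ω) u') =O[atTop]
      fun n : ℕ => ((n : ℝ) + 1) ^ (-β))
    (hpβ : 1 - β < p) (hpq : 1 - q < p) (hpq' : 1 / 2 + q < p)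
    {z : PiLp 2 E} (hz : IsNash A u' z) :
    ∀ᵐ ω ∂P, Tendsto (fun n => Xhat n ω) atTop (𝓝 z) := by
  set γ : ℕ → ℝ := fun n => γ₀ * ((n : ℝ) + 1) ^ (-p) with hγ
  set δ : ℕ → ℝ := fun n => δ₀ * ((n : ℝ) + 1) ^ (-q) with hδ
  have hγpos : ∀ n, 0 < γ n := fun n => by positivity
  have hδpos : ∀ n, 0 < δ n := fun n => by positivity
  have hδr' : ∀ n i, δ n ≤ r i := fun n i => (radius_le hδ₀ hq.le n).trans (hδr i).le
  obtain ⟨C, hC0, hmaster⟩ := hX.exists_energy_le hu hA hAc hs hh (fun n => (hγpos n).le) hδpos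
    hδr' hw
  obtain ⟨ξ, hξm, hξb, hξc, hE⟩ := hmaster (fun _ _ => z) (fun _ => stronglyMeasurable_const)
    fun _ _ => hz.1
  obtain ⟨R, hR⟩ := (isCompact_actionSpace hA).isBounded.exists_norm_le
  obtain ⟨B, hB0, hB⟩ := exists_norm_Xhat_sub_le (Ω := Ω) (w := w) (u := u) (h := h) (grad := grad)
    (b := b) hA hs
  have hγs : ¬ Summable γ := by
    intro hsum
    have h1 := hsum.mul_left γ₀⁻¹
    have h2 : (fun n => γ₀⁻¹ * γ n) = fun n : ℕ => ((n : ℝ) + 1) ^ (-p) := by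
      ext n
      simp only [hγ]
      rw [inv_mul_cancel_left₀ hγ₀.ne']
    rw [h2, summable_succ_rpow_iff] at h1
    linarith
  have hs1 : Summable fun n => γ n * (C * δ n) := by
    have h1 : Summable fun n : ℕ => C * (γ₀ * δ₀ * ((n : ℝ) + 1) ^ (-(p + q))) :=
      ((summable_succ_rpow_iff.2 (by linarith)).mul_left _).mul_left _
    refine h1.congr fun n => ?_
    rw [← step_mul_radius]; simp only [hγ, hδ]; ring
  have hs2 : Summable fun n => (γ n / δ n) ^ 2 := by
    have h1 : Summable fun n : ℕ => (γ₀ / δ₀) ^ 2 * ((n : ℝ) + 1) ^ (2 * (q - p)) :=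
      (summable_succ_rpow_iff.2 (by linarith)).mul_left _
    exact h1.congr fun n => sq_step_div_radius n |>.symm
  have hmart := ae_tendsto_sum_martingale_diff (P := P) (ξ := fun n ω => γ n * ξ n ω)
    (a := fun n => C * (γ n / δ n)) (fun n => (hξm n).const_mul _)
    (fun n ω => by
      rw [abs_mul, abs_of_pos (hγpos n)]
      calc γ n * |ξ n ω| ≤ γ n * (C / δ n) := mul_le_mul_of_nonneg_left (hξb n ω) (hγpos n).le
        _ = C * (γ n / δ n) := by ring)
    (fun n => by
      have h1 := condExp_smul (μ := P) (γ n) (ξ n) (ℱ n)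
      filter_upwards [h1, hξc n] with ω a1 a2
      change P[γ n • ξ n | ℱ n] ω = 0
      rw [a1, Pi.smul_apply, a2, Pi.zero_apply, smul_zero])
    (by simpa only [mul_pow] using hs2.mul_left (C ^ 2))
  filter_upwards [hdist, hmart] with ω hω₁ ⟨l, hl⟩
  have hs3 : Summable fun n => γ n * (gameDistance A (u n ω) u' * (2 * R)) := by
    refine summable_of_isBigO_nat (g := fun n : ℕ => ((n : ℝ) + 1) ^ (-(p + β)))
      (summable_succ_rpow_iff.2 (by linarith)) ?_
    have h1 : (fun n : ℕ => γ₀ * ((n : ℝ) + 1) ^ (-p)) =O[atTop]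
        fun n : ℕ => ((n : ℝ) + 1) ^ (-p) := (isBigO_refl _ _).const_mul_left γ₀
    have h2 : (fun n : ℕ => gameDistance A (u n ω) u' * (2 * R)) =O[atTop]
        fun n : ℕ => ((n : ℝ) + 1) ^ (-β) := by
      simpa only [mul_comm] using hω₁.const_mul_left (2 * R)
    refine (h1.mul h2).congr_right fun n => ?_
    rw [neg_add, Real.rpow_add (by positivity)]
  have hsum := (hs1.add ((hs2.mul_left C).add hs3)).hasSum.tendsto_sum_nat.add hl
  have hθ : Tendsto (fun N => ∑ n ∈ Finset.range N, (γ n * (C * δ n) + (C * (γ n / δ n) ^ 2 +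
      γ n * (gameDistance A (u n ω) u' * (2 * R))) + γ n * ξ n ω)) atTop
      (𝓝 (∑' n, (γ n * (C * δ n) + (C * (γ n / δ n) ^ 2 +
        γ n * (gameDistance A (u n ω) u' * (2 * R)))) + l)) := by
    simpa only [← Finset.sum_add_distrib] using hsum
  have hconv : Tendsto (fun n => X n ω) atTop (𝓝 z) := by
    refine tendsto_nash_of_energy_le hu' hm hA hAc hh hz (fun n => hX.mem n ω)
      (fun n => (hγpos n).le) hγs hθ fun n => ?_
    have h1 := hE n ω
    have h2 : pairing (payoffGradient (u n ω) (X n ω)) (X n ω - z) ≤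
        pairing (payoffGradient u' (X n ω)) (X n ω - z) +
          gameDistance A (u n ω) u' * (2 * R) := by
      have a1 := (le_abs_self _).trans (abs_pairing_le
        (payoffGradient (u n ω) (X n ω) - payoffGradient u' (X n ω)) (X n ω - z))
      rw [pairing_sub_left] at a1
      have a2 := sum_norm_payoffGradient_sub_le_gameDistance (hu.concave n ω) hu' hA (hX.mem n ω)
      have a3 : ‖X n ω - z‖ ≤ 2 * R :=
        (norm_sub_le _ _).trans (by linarith [hR _ (hX.mem n ω), hR _ hz.1])
      have a4 := mul_le_mul a2 a3 (norm_nonneg _)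
        ((Finset.sum_nonneg fun _ _ => norm_nonneg _).trans a2)
      simp only [PiLp.sub_apply] at a1
      linarith
    have h3 := mul_le_mul_of_nonneg_left h2 (hγpos n).le
    linarith
  have hdiff : Tendsto (fun n => Xhat n ω - X n ω) atTop (𝓝 0) := by
    have h1 : Tendsto (fun n => B * δ n) atTop (𝓝 0) := by
      simpa using ((tendsto_succ_rpow_neg hq).const_mul δ₀).const_mul B
    exact squeeze_zero_norm (fun n => hB _ _ _ _ hδpos hX n ω) h1
  simpa using hdiff.add hconv

/-- The pathwise tracking inequality of payoff-based play in strongly monotone games. -/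
theorem exists_tracking_inequality (hA : ∀ i, IsCompact (A i)) (hAc : ∀ i, Convex ℝ (A i))
    (hu : IsTimeVaryingGame ℱ A u) (hh : ∀ i, IsLipschitzDGF (A i) (h i) (grad i))
    (hs : IsSafe A b base r) {γ δ : ℕ → ℝ} (hγ : ∀ n, 0 < γ n) (hγa : Antitone γ)
    (hδ : ∀ n, 0 < δ n) (hδr : ∀ n i, δ n ≤ r i) (hw : IsUniformSampling P ℱ w)
    (hX : IsPayoffBasedPlay A u b h grad base r γ δ w X Xhat)
    {μ : ℝ} {z : ℕ → Ω → PiLp 2 E} (hm : ∀ n ω, IsStronglyMonotone A (u n ω) μ)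
    (hz : ∀ n ω, IsNash A (u n ω) (z n ω)) (hzm : ∀ n, StronglyMeasurable[ℱ n] (z n)) :
    ∃ C : ℝ, 0 ≤ C ∧ ∃ ξ : ℕ → Ω → ℝ, (∀ n, Integrable (ξ n) P) ∧ (∀ n, ∫ ω, ξ n ω ∂P = 0) ∧
      ∀ ω N, μ * ∑ n ∈ Finset.range (N + 1), ‖X n ω - z n ω‖ ^ 2 ≤
        (γ N)⁻¹ * (C + ∑ n ∈ Finset.range (N + 1), C * ‖z (n + 1) ω - z n ω‖) +
          ∑ n ∈ Finset.range (N + 1), (C * δ n + C * (γ n / δ n ^ 2) + ξ n ω) := by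
  obtain ⟨C, hC0, hmaster⟩ := hX.exists_energy_le hu hA hAc hs hh (fun n => (hγ n).le) hδ hδr hw
  obtain ⟨ξ, hξm, hξb, hξc, hE⟩ := hmaster z hzm fun n ω => (hz n ω).1
  obtain ⟨R, hR⟩ := (isCompact_actionSpace hA).isBounded.exists_norm_le
  obtain ⟨κ, hκ, hlow⟩ := exists_mul_norm_sq_le_energy hA hh
  obtain ⟨c, hc0, hdrift⟩ := exists_energy_drift_le hA hh
  have hξi : ∀ n, Integrable (ξ n) P := fun n =>
    integrable_of_abs_le ((hξm n).mono (ℱ.le _)) (hξb n)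
  refine ⟨C + c + |c * (2 * R)|, by positivity, ξ, hξi,
    fun n => integral_eq_zero_of_condExp (ℱ.le n) (hξc n), fun ω N => ?_⟩
  set C' := C + c + |c * (2 * R)| with hC'
  have habs := abs_nonneg (c * (2 * R))
  have hE0 : ∀ n, 0 ≤ energy h grad (z n ω) (X n ω) := fun n =>
    (by positivity : 0 ≤ κ * ‖z n ω - X n ω‖ ^ 2).trans (hlow _ (hX.mem n ω) _ (hz n ω).1)
  have hEB : ∀ n, energy h grad (z n ω) (X n ω) ≤ C' := by
    intro n
    have h1 := hdrift _ (hX.mem n ω) _ (hX.mem n ω) _ (hz n ω).1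
    rw [energy_self, zero_add] at h1
    have h2 : ‖z n ω - X n ω‖ ≤ 2 * R :=
      (norm_sub_le _ _).trans (by linarith [hR _ (hX.mem n ω), hR _ (hz n ω).1])
    have h3 := mul_le_mul_of_nonneg_left h2 hc0
    have h4 := le_abs_self (c * (2 * R))
    linarith
  refine sum_le_of_energy_le hγ hγa hE0 hEB (fun n => by positivity) (fun n => ?_) N
  have h1 := hE n ω
  have h2 := hdrift _ (hX.mem (n + 1) ω) _ (hz n ω).1 _ (hz (n + 1) ω).1
  have h3 : pairing (payoffGradient (u n ω) (X n ω)) (X n ω - z n ω) ≤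
      -(μ * ‖X n ω - z n ω‖ ^ 2) := by
    have a1 := hm n ω _ (hz n ω).1 _ (hX.mem n ω)
    have a2 := (hz n ω).pairing_le (hu.concave n ω) hAc (hX.mem n ω)
    rw [pairing_sub_left] at a1
    linarith
  have h4 := mul_le_mul_of_nonneg_left h3 (hγ n).le
  have h5 : C * (γ n / δ n) ^ 2 = γ n * (C * (γ n / δ n ^ 2)) := by ring
  have h6 : γ n * (C * (γ n / δ n ^ 2)) ≤ γ n * (C' * (γ n / δ n ^ 2)) := by
    have := hγ n
    have := hδ n
    gcongr
    linarith
  have h7 : γ n * (C * δ n) ≤ γ n * (C' * δ n) := by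
    have := hγ n
    have := hδ n
    gcongr
    linarith
  have h8 : c * ‖z (n + 1) ω - z n ω‖ ≤ C' * ‖z (n + 1) ω - z n ω‖ := by
    gcongr
    linarith
  rw [h5] at h1
  linarith

/-- The expected tracking error of payoff-based play in strongly monotone games. -/
theorem exists_expected_tracking_error_le (hA : ∀ i, IsCompact (A i))
    (hAc : ∀ i, Convex ℝ (A i))
    (hu : IsTimeVaryingGame ℱ A u) (hh : ∀ i, IsLipschitzDGF (A i) (h i) (grad i))
    (hs : IsSafe A b base r) (hp0 : 0 < p) (hp1 : p ≤ 1) (hq : 0 < q) (hγ₀ : 0 < γ₀)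
    (hδ₀ : 0 < δ₀) (hδr : ∀ i, δ₀ < r i) (hw : IsUniformSampling P ℱ w)
    (hX : IsPayoffBasedPlay A u b h grad base r
      (fun n => γ₀ * ((n : ℝ) + 1) ^ (-p)) (fun n => δ₀ * ((n : ℝ) + 1) ^ (-q)) w X Xhat)
    {μ β : ℝ} {z : ℕ → Ω → PiLp 2 E} (hμ : 0 < μ) (hβ : 0 ≤ β)
    (hm : ∀ n ω, IsStronglyMonotone A (u n ω) μ)
    (hz : ∀ n ω, IsNash A (u n ω) (z n ω)) (hzm : ∀ n, StronglyMeasurable[ℱ n] (z n))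
    {V : ℝ} (hV : ∀ T : ℕ, 1 ≤ T → ∀ᵐ ω ∂P,
      ∑ n ∈ Finset.range T, ‖z (n + 1) ω - z n ω‖ ≤ V * (T : ℝ) ^ β) :
    (∀ T : ℕ, Integrable (fun ω => ∑ n ∈ Finset.range T, ‖Xhat n ω - z n ω‖ ^ 2) P) ∧
    ∃ C : ℝ, ∀ T : ℕ, 1 ≤ T →
      ∫ ω, ∑ n ∈ Finset.range T, ‖Xhat n ω - z n ω‖ ^ 2 ∂P ≤
        C * ((T : ℝ) ^ (1 + 2 * q - p) + (T : ℝ) ^ (1 - q) + (T : ℝ) ^ (2 * p - 2 * q + β)) := by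
  set γ : ℕ → ℝ := fun n => γ₀ * ((n : ℝ) + 1) ^ (-p) with hγ
  set δ : ℕ → ℝ := fun n => δ₀ * ((n : ℝ) + 1) ^ (-q) with hδ
  have hγpos : ∀ n, 0 < γ n := fun n => by positivity
  have hδpos : ∀ n, 0 < δ n := fun n => by positivity
  have hδle : ∀ n, δ n ≤ δ₀ := fun n => radius_le hδ₀ hq.le n
  have hδr' : ∀ n i, δ n ≤ r i := fun n i => (hδle n).trans (hδr i).le
  have hγa : Antitone γ := (antitone_succ_rpow_neg hp0.le).const_mul hγ₀.le
  obtain ⟨R, hR⟩ := (isCompact_actionSpace hA).isBounded.exists_norm_le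
  have hXhat : ∀ n ω, Xhat n ω ∈ actionSpace A := fun n ω => by
    rw [hX.Xhat_eq]
    exact queryProfile_mem hAc hs (hX.mem n ω) (hδpos n) (hδr' n) _
  have hdiam : ∀ x ∈ actionSpace A, ∀ n ω, ‖x - z n ω‖ ^ 2 ≤ (2 * R) ^ 2 := fun x hx n ω =>
    pow_le_pow_left₀ (norm_nonneg _)
      ((norm_sub_le _ _).trans (by linarith [hR _ hx, hR _ (hz n ω).1])) 2
  have hint : ∀ T : ℕ,
      Integrable (fun ω => ∑ n ∈ Finset.range T, ‖Xhat n ω - z n ω‖ ^ 2) P := by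
    refine fun T => integrable_finsetSum _ fun n _ => ?_
    have h1 := (hX.stronglyMeasurable_Xhat hu hA hAc hs hh hδpos hδr' hw n).mono (ℱ.le _)
    refine integrable_of_abs_le ((h1.sub ((hzm n).mono (ℱ.le _))).norm.pow 2) (C := (2 * R) ^ 2)
      fun ω => ?_
    rw [abs_of_nonneg (sq_nonneg _)]
    exact hdiam _ (hXhat n ω) n ω
  refine ⟨hint, ?_⟩
  rcases lt_or_ge p (2 * q) with hpq | hpq
  · refine ⟨(2 * R) ^ 2, fun T hT => ?_⟩
    have hT1 : (1 : ℝ) ≤ T := by exact_mod_cast hT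
    have h1 : ∫ ω, ∑ n ∈ Finset.range T, ‖Xhat n ω - z n ω‖ ^ 2 ∂P ≤ (2 * R) ^ 2 * T := by
      calc _ ≤ ∫ _, (2 * R) ^ 2 * (T : ℝ) ∂P := by
            refine integral_mono (hint T) (integrable_const _) fun ω => ?_
            refine (Finset.sum_le_sum fun n _ => hdiam _ (hXhat n ω) n ω).trans (le_of_eq ?_)
            simp [mul_comm]
        _ = _ := by simp
    have h2 : (T : ℝ) ≤ (T : ℝ) ^ (1 + 2 * q - p) := by
      conv_lhs => rw [← Real.rpow_one (T : ℝ)]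
      exact Real.rpow_le_rpow_of_exponent_le hT1 (by linarith)
    refine h1.trans (mul_le_mul_of_nonneg_left ?_ (sq_nonneg _))
    have h3 : 0 ≤ (T : ℝ) ^ (1 - q) := by positivity
    have h4 : 0 ≤ (T : ℝ) ^ (2 * p - 2 * q + β) := by positivity
    linarith
  · obtain ⟨C, hC0, ξ, hξi, hξ0, htrack⟩ := exists_tracking_inequality hA hAc hu hh hs hγpos hγa
      hδpos hδr' hw hX hm hz hzm
    obtain ⟨B, hB0, hB⟩ := exists_norm_Xhat_sub_le (Ω := Ω) (w := w) (u := u) (h := h)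
      (grad := grad) (b := b) hA hs
    set K₁ := C * (γ₀ / δ₀ ^ 2) / (1 + (2 * q - p)) with hK₁
    set K₂ := δ₀ / (1 - q) with hK₂
    set K₃ := γ₀⁻¹ * (C + C * |V|) with hK₃
    have hK₁0 : 0 ≤ K₁ := by
      have : 0 < 1 + (2 * q - p) := by linarith
      positivity
    have hK₂0 : 0 ≤ K₂ := div_nonneg hδ₀.le (by linarith)
    have hK₃0 : 0 ≤ K₃ := by positivity
    refine ⟨2 * μ⁻¹ * (K₁ + C * K₂ + K₃) + 2 * B ^ 2 * δ₀ * K₂, fun T hT => ?_⟩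
    obtain ⟨N, rfl⟩ : ∃ N, T = N + 1 := ⟨T - 1, by omega⟩
    have hT1 : (1 : ℝ) ≤ (N + 1 : ℕ) := by exact_mod_cast hT
    set a := ((N + 1 : ℕ) : ℝ) ^ (1 + 2 * q - p) with ha
    set b' := ((N + 1 : ℕ) : ℝ) ^ (1 - q) with hb'
    set c' := ((N + 1 : ℕ) : ℝ) ^ (2 * p - 2 * q + β) with hc'
    have ha0 : 0 ≤ a := by positivity
    have hb0 : 0 ≤ b' := by positivity
    have hc0 : 0 ≤ c' := by positivity
    have hδsum : ∑ n ∈ Finset.range (N + 1), δ n ≤ K₂ * b' := by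
      have h1 := sum_succ_rpow_le (s := -q) (by linarith) (by linarith) (N + 1)
      simp only [hδ]
      rw [← Finset.mul_sum]
      refine (mul_le_mul_of_nonneg_left h1 hδ₀.le).trans (le_of_eq ?_)
      rw [hK₂, hb', ← sub_eq_add_neg]; ring
    have hγsum : ∑ n ∈ Finset.range (N + 1), C * (γ n / δ n ^ 2) ≤ K₁ * a := by
      have h1 := sum_succ_rpow_le (s := 2 * q - p) (by linarith) (by linarith) (N + 1)
      have h2 : ∀ n, C * (γ n / δ n ^ 2) =
          C * (γ₀ / δ₀ ^ 2) * ((n : ℝ) + 1) ^ (2 * q - p) := by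
        intro n
        have hn : (0 : ℝ) < (n : ℝ) + 1 := by positivity
        simp only [hγ, hδ]
        rw [show 2 * q - p = -p - -q * 2 by ring, Real.rpow_sub hn, Real.rpow_mul hn.le,
          Real.rpow_two]
        ring
      simp only [h2]
      rw [← Finset.mul_sum]
      refine (mul_le_mul_of_nonneg_left h1 (by positivity)).trans (le_of_eq ?_)
      rw [hK₁, ha, ← add_sub_assoc]; ring
    have hfirst : (γ N)⁻¹ * (C + C * (V * ((N + 1 : ℕ) : ℝ) ^ β)) ≤ K₃ * c' := by
      have hTpos : (0 : ℝ) < ((N + 1 : ℕ) : ℝ) := by positivity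
      have h1 : (γ N)⁻¹ = γ₀⁻¹ * ((N + 1 : ℕ) : ℝ) ^ p := by
        simp only [hγ]
        rw [mul_inv, Real.rpow_neg (by positivity), inv_inv]
        push_cast
        rfl
      have h2 : ((N + 1 : ℕ) : ℝ) ^ p ≤ c' :=
        Real.rpow_le_rpow_of_exponent_le hT1 (by linarith)
      have h3 : ((N + 1 : ℕ) : ℝ) ^ p * ((N + 1 : ℕ) : ℝ) ^ β ≤ c' := by
        rw [← Real.rpow_add hTpos]
        exact Real.rpow_le_rpow_of_exponent_le hT1 (by linarith)
      have h4 : V * (((N + 1 : ℕ) : ℝ) ^ p * ((N + 1 : ℕ) : ℝ) ^ β) ≤ |V| * c' :=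
        (mul_le_mul_of_nonneg_right (le_abs_self V) (by positivity)).trans
          (mul_le_mul_of_nonneg_left h3 (abs_nonneg V))
      rw [h1]
      calc _ = γ₀⁻¹ * (C * ((N + 1 : ℕ) : ℝ) ^ p +
            C * (V * (((N + 1 : ℕ) : ℝ) ^ p * ((N + 1 : ℕ) : ℝ) ^ β))) := by ring
        _ ≤ γ₀⁻¹ * (C * c' + C * (|V| * c')) := by gcongr
        _ = K₃ * c' := by rw [hK₃]; ring
    set D := 2 * μ⁻¹ * (K₃ * c' + (C * (K₂ * b') + K₁ * a)) + 2 * B ^ 2 * (δ₀ * (K₂ * b')) with hD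
    have hpath : ∀ᵐ ω ∂P, ∑ n ∈ Finset.range (N + 1), ‖Xhat n ω - z n ω‖ ^ 2 ≤
        D + 2 * μ⁻¹ * ∑ n ∈ Finset.range (N + 1), ξ n ω := by
      filter_upwards [hV (N + 1) hT] with ω hω
      have h1 := htrack ω N
      rw [← Finset.mul_sum, Finset.sum_add_distrib, Finset.sum_add_distrib,
        ← Finset.mul_sum (s := Finset.range (N + 1)) (f := δ)] at h1
      have h2 : (γ N)⁻¹ * (C + C * ∑ n ∈ Finset.range (N + 1), ‖z (n + 1) ω - z n ω‖) ≤
          K₃ * c' := by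
        refine le_trans ?_ hfirst
        have := (hγpos N).le
        gcongr
      have h3 : C * ∑ n ∈ Finset.range (N + 1), δ n ≤ C * (K₂ * b') :=
        mul_le_mul_of_nonneg_left hδsum hC0
      have h4 : ∑ n ∈ Finset.range (N + 1), ‖X n ω - z n ω‖ ^ 2 ≤
          μ⁻¹ * (K₃ * c' + (C * (K₂ * b') + K₁ * a) +
            ∑ n ∈ Finset.range (N + 1), ξ n ω) := by
        rw [inv_mul_eq_div, le_div_iff₀ hμ, mul_comm]
        linarith
      have h5 : ∀ n, ‖Xhat n ω - z n ω‖ ^ 2 ≤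
          2 * ‖X n ω - z n ω‖ ^ 2 + 2 * B ^ 2 * (δ₀ * δ n) := by
        intro n
        have a1 := hB _ _ _ _ hδpos hX n ω
        have a2 : ‖Xhat n ω - z n ω‖ ≤ ‖Xhat n ω - X n ω‖ + ‖X n ω - z n ω‖ := by
          simpa using norm_add_le (Xhat n ω - X n ω) (X n ω - z n ω)
        have a3 : ‖Xhat n ω - X n ω‖ ^ 2 ≤ B ^ 2 * (δ₀ * δ n) := by
          refine (pow_le_pow_left₀ (norm_nonneg _) a1 2).trans ?_
          rw [mul_pow, sq (δ n)]
          have := (hδpos n).le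
          gcongr
          exact hδle n
        have a4 := pow_le_pow_left₀ (norm_nonneg _) a2 2
        nlinarith [sq_nonneg (‖Xhat n ω - X n ω‖ - ‖X n ω - z n ω‖)]
      refine (Finset.sum_le_sum fun n _ => h5 n).trans ?_
      rw [Finset.sum_add_distrib, ← Finset.mul_sum, ← Finset.mul_sum, ← Finset.mul_sum]
      have h6 : 2 * B ^ 2 * (δ₀ * ∑ n ∈ Finset.range (N + 1), δ n) ≤
          2 * B ^ 2 * (δ₀ * (K₂ * b')) := by gcongr
      rw [hD]
      linarith
    have hsumi : Integrable (fun ω => ∑ n ∈ Finset.range (N + 1), ξ n ω) P :=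
      integrable_finsetSum _ fun n _ => hξi n
    have hle := integral_mono_ae (hint (N + 1))
      ((integrable_const D).add (hsumi.const_mul (2 * μ⁻¹))) hpath
    refine hle.trans ?_
    simp only [Pi.add_apply]
    rw [integral_add (integrable_const D) (hsumi.const_mul (2 * μ⁻¹)), integral_const_mul,
      integral_finsetSum _ fun n _ => hξi n]
    simp only [hξ0, Finset.sum_const_zero, mul_zero, add_zero, integral_const, probReal_univ,
      one_smul]
    rw [hD, add_mul]
    have hμ' : 0 ≤ 2 * μ⁻¹ := by positivity
    have e1 : K₃ * c' + (C * (K₂ * b') + K₁ * a) ≤ (K₁ + C * K₂ + K₃) * (a + b' + c') := by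
      have := mul_nonneg hK₁0 hb0
      have := mul_nonneg hK₁0 hc0
      have := mul_nonneg (mul_nonneg hC0 hK₂0) ha0
      have := mul_nonneg (mul_nonneg hC0 hK₂0) hc0
      have := mul_nonneg hK₃0 ha0
      have := mul_nonneg hK₃0 hb0
      linarith
    have e2 : 2 * B ^ 2 * (δ₀ * (K₂ * b')) ≤ 2 * B ^ 2 * δ₀ * K₂ * (a + b' + c') := by
      have : b' ≤ a + b' + c' := by linarith
      calc _ = 2 * B ^ 2 * δ₀ * K₂ * b' := by ring
        _ ≤ _ := by gcongr
    have e3 := mul_le_mul_of_nonneg_left e1 hμ'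
    linarith

end Main

end PayoffLearning

theorem mainTheorem3 {ι : Type*} [Fintype ι] [DecidableEq ι]
    {E : ι → Type*} [∀ i, NormedAddCommGroup (E i)] [∀ i, NormedSpace ℝ (E i)]
    [∀ i, FiniteDimensional ℝ (E i)]
    {d : ι → ℕ} (b : ∀ i, Module.Basis (Fin (d i)) ℝ (E i))
    (A : ∀ i, Set (E i)) (hA_compact : ∀ i, IsCompact (A i)) (hA_convex : ∀ i, Convex ℝ (A i))
    {Ω : Type*} {mΩ : MeasurableSpace Ω} (P : Measure Ω) [IsProbabilityMeasure P]
    (ℱ : Filtration ℕ mΩ)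
    (u : ℕ → Ω → ι → PiLp 2 E → ℝ) (hu : IsTimeVaryingGame ℱ A u)
    (h : ∀ i, E i → ℝ) (grad : ∀ i, E i → StrongDual ℝ (E i))
    (hh : ∀ i, IsLipschitzDGF (A i) (h i) (grad i))
    (base : ∀ i, E i) (r : ι → ℝ) (hsafe : IsSafe A b base r)
    (p q γ₀ δ₀ : ℝ) (hp : p ∈ Set.Ioc (0 : ℝ) 1) (hq : q ∈ Set.Ioc (0 : ℝ) 1)
    (hγ₀ : 0 < γ₀) (hδ₀ : 0 < δ₀) (hδr : ∀ i, δ₀ < r i)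
    (w : ℕ → Ω → ∀ i, Direction (d i)) (hw : IsUniformSampling P ℱ w)
    (X Xhat : ℕ → Ω → PiLp 2 E)
    (hX : IsPayoffBasedPlay A u b h grad base r
      (fun n => γ₀ * ((n : ℝ) + 1) ^ (-p)) (fun n => δ₀ * ((n : ℝ) + 1) ^ (-q)) w X Xhat) :
    -- games that stabilize to a strictly monotone game
    (∀ (u' : ι → PiLp 2 E → ℝ) (β : ℝ), IsConcaveGame A u' → IsStrictlyMonotone A u' →
      (∀ᵐ ω ∂P, (fun n : ℕ => gameDistance A (u n ω) u') =O[atTop]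
        fun n : ℕ => ((n : ℝ) + 1) ^ (-β)) →
      max (1 - β) (max (1 - q) (1 / 2 + q)) < p →
      ∃ xstar : PiLp 2 E, IsNash A u' xstar ∧ (∀ y, IsNash A u' y → y = xstar) ∧
        ∀ᵐ ω ∂P, Tendsto (fun n => Xhat n ω) atTop (𝓝 xstar))
    ∧
    -- strongly monotone games with bounded equilibrium drift
    (∀ (μ β : ℝ) (xstar : ℕ → Ω → PiLp 2 E), 0 < μ → 0 ≤ β → β < 1 →
      (∀ n ω, IsStronglyMonotone A (u n ω) μ) →
      (∀ n ω, IsNash A (u n ω) (xstar n ω)) →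
      (∀ n, StronglyMeasurable[ℱ n] (xstar n)) →
      (∃ C : ℝ, ∀ T : ℕ, 1 ≤ T → ∀ᵐ ω ∂P,
        ∑ n ∈ Finset.range T, ‖xstar (n + 1) ω - xstar n ω‖ ≤ C * (T : ℝ) ^ β) →
      (∀ T : ℕ,
        Integrable (fun ω => ∑ n ∈ Finset.range T, ‖Xhat n ω - xstar n ω‖ ^ 2) P) ∧
      (∃ C : ℝ, ∀ T : ℕ, 1 ≤ T →
        ∫ ω, ∑ n ∈ Finset.range T, ‖Xhat n ω - xstar n ω‖ ^ 2 ∂P ≤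
          C * ((T : ℝ) ^ (1 + 2 * q - p) + (T : ℝ) ^ (1 - q) + (T : ℝ) ^ (2 * p - 2 * q + β))) ∧
      (p = 3 * (1 - β) / 5 → q = (1 - β) / 5 →
        ∃ C : ℝ, ∀ T : ℕ, 1 ≤ T →
          ∫ ω, ∑ n ∈ Finset.range T, ‖Xhat n ω - xstar n ω‖ ^ 2 ∂P ≤
            C * (T : ℝ) ^ ((4 + β) / 5))) := by
  refine ⟨fun u' β hu' hm hdist hpmax => ?_, fun μ β xstar hμ hβ _ hm hz hzm hdrift => ?_⟩
  · obtain ⟨h1, h2⟩ := max_lt_iff.1 hpmax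
    obtain ⟨h2, h3⟩ := max_lt_iff.1 h2
    obtain ⟨z, hz⟩ := exists_isNash hu' hA_compact hA_convex hm hh
    exact ⟨z, hz, fun y hy => hz.unique hu' hA_convex hm hy,
      ae_tendsto_nash_of_stabilizing hA_compact hA_convex hu hh hsafe hp.2 hq.1 hγ₀ hδ₀ hδr hw hX
        hu' hm hdist h1 h2 h3 hz⟩
  · obtain ⟨V, hV⟩ := hdrift
    obtain ⟨hint, C, hC⟩ := exists_expected_tracking_error_le hA_compact hA_convex hu hh hsafe
      hp.1 hp.2 hq.1 hγ₀ hδ₀ hδr hw hX hμ hβ hm hz hzm hV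
    refine ⟨hint, ⟨C, hC⟩, fun hp' hq' => ⟨C * 3, fun T hT => (hC T hT).trans (le_of_eq ?_)⟩⟩
    have e1 : 1 + 2 * q - p = (4 + β) / 5 := by rw [hp', hq']; ring
    have e2 : 1 - q = (4 + β) / 5 := by rw [hq']; ring
    have e3 : 2 * p - 2 * q + β = (4 + β) / 5 := by rw [hp', hq']; ring
    rw [e1, e2, e3]
    ring
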